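/- Let $n\ge 0$, let $B_n$ be the group of signed permutations, i.e. the permutations $\sigma$ of $\{\pm1,\dots,\pm n\}$ with $\sigma(-x)=-\sigma(x)$, let $\mathbf r=(r_1\le r_2\le\dots\le r_n\le n)$ be a nondecreasing sequence of nonnegative integers, and let $B_{\mathbf r}=\{\sigma\in B_n: |\sigma(k)|\le r_k \text{ for } 1\le k\le n\}$. Fix $\sigma_0\in B_{\mathbf r}$ with $\sigma_0(k)>0$ for $1\le k\le n$ (so $r_k\ge k$ for all $k$). Let $D(\mathbf r)$ be the Dyck path with $n$ rises and $n$ falls whose $k$-th fall is preceded by exactly $r_k$ rises, let $o_k$ and $c_k$ be the positions (in $\{1,\dots,2n\}$) of its $k$-th rise and of its $k$-th fall, and let $h_k=k-|\{i:r_i<k\}|$ be the height of the right endpoint of the $k$-th rise. Put $[m]_q=1+q+\dots+q^{m-1}$. *Sorting index.* To $\sigma\in B_{\mathbf r}$ associate the matching $M$ on $\{1,\dots,2n\}$ with arcs $o_{|\sigma(k)|}\cdot c_k$, colored $0$ if $\sigma(k)>0$ and $1$ if $\sigma(k)<0$; let $M_0$ be the matching of $\sigma_0$. For a vertex $v$ write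 $M(v)$ for the vertex joined to it. Put $M_n=M$. For $k=n,n-1,\dots,1$, obtain $M_{k-1}$ from $M_k$ as follows: if $M_k(o_k)=M_0(o_k)$, recolor the arc at $o_k$ with $0$; otherwise, with $o_l=M_k(M_0(o_k))$, replace the arcs $o_k\cdot M_k(o_k)$ and $o_l\cdot M_0(o_k)$ by $o_k\cdot M_0(o_k)$ and $o_l\cdot M_k(o_k)$, and add the color of $o_k$ in $M_k$ to the colors of $o_k$ and $o_l$, modulo $2$. Let $a_k$ be the number of closers $c>o_k$ with $M_0(c)<o_k$ such that $c\in[M_k(o_k),M_0(o_k)]$ if $M_k(o_k)\le M_0(o_k)$, respectively $c\notin(M_0(o_k),M_k(o_k))$ if $M_0(o_k)<M_k(o_k)$. Then $\mathrm{sor}_{\mathbf r}(\sigma,\sigma_0)=\sum_{k=1}^n b_k$, where $b_k=a_k$ if $o_k$ has color $0$ in $M_k$, and $b_k=2k-1-a_k$ if it has color $1$. *Other statistics.* A cycle of $\pi\in B_n$ on $\{\pm1,\dots,\pm n\}$ is unbalanced if it contains a letter and its negative, and balanced otherwise; $\mathrm{Cyc}_0(\pi)$ (resp. $\mathrm{Cyc}_1(\pi)$)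 is the set of the minimal absolute values in the balanced (resp. unbalanced) cycles of $\pi$. For $0<j$ and $-j\le i<j$, $i\neq 0$, the transposition $(i\,j)$ swaps $i$ with $j$ and $-i$ with $-j$ (if $i=-j$, it swaps $j$ with $-j$). The reflection length $\ell'_B(\sigma)$ is the minimal number of such transpositions whose product is $\sigma$. Writing uniquely $\sigma=(i_1\,j_1)\cdots(i_m\,j_m)$ with transpositions of this kind and $j_1<\dots<j_m$, put $\mathrm{sor}_B(\sigma)=\sum_s (j_s-i_s-\chi(i_s<0))$. Let $N(\sigma)=|\{k\in\{1,\dots,n\}:\sigma(k)<0\}|$, $$\mathrm{inv}_B(\sigma)=|\{i<j:\sigma(i)>\sigma(j)\}|+|\{i<j:-\sigma(i)>\sigma(j)\}|+N(\sigma),$$ $$\mathrm{nmin}_B(\sigma)=|\{i:\sigma(i)>|\sigma(j)|\text{ for some }j>i\}|+N(\sigma),$$ $$\mathrm{Prlminl}(\sigma)=\{\sigma(k):0<\sigma(k)<|\sigma(l)|\text{ for all }l>k\},$$ with $i,j,k,l\in\{1,\dots,n\}$. **Theorem.** For all elements $q,x,t_1,\dots,t_n,s_1,\dots,s_n$ of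 a commutative ring: 1. $\displaystyle\sum_{\sigma\in B_{\mathbf r}}q^{\mathrm{sor}_{\mathbf r}(\sigma,\sigma_0)}\prod_{i\in\mathrm{Cyc}_0(\sigma\sigma_0^{-1})}t_i\prod_{i\in\mathrm{Cyc}_1(\sigma\sigma_0^{-1})}s_i=\prod_{k=1}^n\bigl(t_k+(q+q^{2k-h_k})[h_k-1]_q+s_kq^{2k-1}\bigr).$ 2. $\displaystyle\sum_{\sigma\in B_{\mathbf r}}q^{\mathrm{sor}_{\mathbf r}(\sigma,\sigma_0)}x^{\ell'_B(\sigma\sigma_0^{-1})}=\prod_{k=1}^n\bigl(1+q[h_k-1]_q\,x+q^{2k-h_k}[h_k]_q\,x\bigr)$, and also $\displaystyle\sum_{\sigma\in B_{\mathbf r}}q^{\mathrm{sor}_B(\sigma)}x^{\ell'_B(\sigma)}$ equals this product. 3. $\displaystyle\sum_{\sigma\in B_{\mathbf r}}q^{\mathrm{sor}_{\mathbf r}(\sigma,\sigma_0)}\prod_{i\in\mathrm{Cyc}_0(\sigma\sigma_0^{-1})}t_i=\sum_{\sigma\in B_{\mathbf r}}q^{\mathrm{inv}_B(\sigma)}\prod_{i\in\mathrm{Prlminl}(\sigma)}t_i=\prod_{k=1}^n\bigl(t_k+q[h_k-1]_q+q^{2k-h_k}[h_k]_q\bigr).$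 4. The pairs $(\mathrm{inv}_B(\sigma),\mathrm{nmin}_B(\sigma))$ and $(\mathrm{sor}_{\mathbf r}(\sigma,\sigma_0),\ell'_B(\sigma\sigma_0^{-1}))$ are equidistributed over $\sigma\in B_{\mathbf r}$: for all $a,b\ge 0$, as many $\sigma \in B_{\mathbf r}$ have the first pair equal to $(a,b)$ as have the second pair equal to $(a,b)$; in particular $$\sum_{\sigma\in B_{\mathbf r}}q^{\mathrm{inv}_B(\sigma)}x^{\mathrm{nmin}_B(\sigma)}=\sum_{\sigma\in B_{\mathbf r}}q^{\mathrm{sor}_{\mathbf r}(\sigma,\sigma_0)}x^{\ell'_B(\sigma\sigma_0^{-1})}.$$ Moreover $\displaystyle\sum_{\sigma\in B_{\mathbf r}}q^{\mathrm{inv}_B(\sigma)}x^{\mathrm{nmin}_B(\sigma)}=\sum_{\sigma\in B_{\mathbf r}}q^{\mathrm{sor}_B(\sigma)}x^{\ell'_B(\sigma)}$, which for $\mathbf r=(n,\dots,n)$, $B_{\mathbf r}=B_n$, is Petersen's equidistribution result. -/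

import Mathlib

/-- The letters `±1, …, ±n`. -/
abbrev Letter (n : ℕ) : Type := ↥((Finset.Icc (-(n : ℤ)) n).erase 0)

namespace Letter

/-- The letter `-x` (written with a bar over `x` on paper). -/
instance (n : ℕ) : Neg (Letter n) where
  neg x := ⟨-x.1, by
    have h := x.2
    simp only [Finset.mem_erase, Finset.mem_Icc] at h ⊢
    omega⟩

/-- The positive letter `k`; the index `k : Fin n` stands for the number `k + 1`. -/
def pos {n : ℕ} (k : Fin n) : Letter n := ⟨(k : ℤ) + 1, by
  have h := k.2
  simp only [Finset.mem_erase, Finset.mem_Icc]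
  omega⟩

/-- The absolute value of a letter, as an index. -/
def idx {n : ℕ} (x : Letter n) : Fin n := ⟨x.1.natAbs - 1, by
  have h := x.2
  simp only [Finset.mem_erase, Finset.mem_Icc] at h
  omega⟩

theorem pos_idx {n : ℕ} (x : Letter n) : pos x.idx = x ∨ pos x.idx = -x := by
  have h := x.2
  simp only [Finset.mem_erase, Finset.mem_Icc] at h
  rcases lt_or_gt_of_ne h.1 with h0 | h0
  · right
    apply Subtype.ext
    change ((x.1.natAbs - 1 : ℕ) : ℤ) + 1 = -x.1
    omega
  · left
    apply Subtype.ext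
    change ((x.1.natAbs - 1 : ℕ) : ℤ) + 1 = x.1
    omega

theorem idx_pos {n : ℕ} (k : Fin n) : (pos k).idx = k := by
  apply Fin.ext
  change ((k : ℤ) + 1).natAbs - 1 = k
  omega

theorem idx_neg {n : ℕ} (x : Letter n) : (-x).idx = x.idx := by
  apply Fin.ext
  change (-x.1).natAbs - 1 = x.1.natAbs - 1
  omega

end Letter

/-- The group `B_n` of signed permutations: the permutations `σ` of `{±1, …, ±n}` with
`σ(-x) = -σ(x)`, under composition. -/
def signedPermGroup (n : ℕ) : Subgroup (Equiv.Perm (Letter n)) where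
  carrier := {σ | ∀ x, σ (-x) = -σ x}
  mul_mem' := by
    intro a b ha hb x
    change a (b (-x)) = -a (b x)
    rw [hb x, ha (b x)]
  one_mem' := fun _ => rfl
  inv_mem' := by
    intro a ha x
    change a.symm (-x) = -a.symm x
    rw [Equiv.symm_apply_eq, ha, Equiv.apply_symm_apply]

/-- The signed permutations in `B_n`. -/
abbrev SignedPerm (n : ℕ) : Type := ↥(signedPermGroup n)

namespace SignedPerm

variable {n : ℕ}

noncomputable instance : DecidablePred (· ∈ signedPermGroup n) := fun σ =>
  inferInstanceAs (Decidable (∀ x, σ (-x) = -σ x))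

/-- The integer `σ(k)`, for the position `k ∈ {1, …, n}`. -/
def val (σ : SignedPerm n) (k : Fin n) : ℤ := (σ.1 (Letter.pos k)).1

/-- `B_r = {σ ∈ B_n : |σ(k)| ≤ r_k for 1 ≤ k ≤ n}`. -/
noncomputable def restricted (r : Fin n → ℕ) : Finset (SignedPerm n) :=
  Finset.univ.filter fun σ => ∀ k, |σ.val k| ≤ r k

/-- `N(σ)`, the number of negative signs in `σ`. -/
noncomputable def numNeg (σ : SignedPerm n) : ℕ := (Finset.univ.filter fun k => σ.val k < 0).card

/-- The number of type `B_n` inversions. -/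
noncomputable def invB (σ : SignedPerm n) : ℕ :=
  (Finset.univ.filter fun p : Fin n × Fin n => p.1 < p.2 ∧ σ.val p.2 < σ.val p.1).card
    + (Finset.univ.filter fun p : Fin n × Fin n => p.1 < p.2 ∧ σ.val p.2 < -σ.val p.1).card
    + σ.numNeg

/-- `nmin_B(σ) = |{i : σ(i) > |σ(j)| for some j > i}| + N(σ)`. -/
noncomputable def nminB (σ : SignedPerm n) : ℕ :=
  (Finset.univ.filter fun i => ∃ j, i < j ∧ |σ.val j| < σ.val i).card + σ.numNeg

/-- The positive right-to-left minimum letters of `σ`: the letters `σ(k)` with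
`0 < σ(k) < |σ(l)|` for all `l > k`. -/
noncomputable def prlminl (σ : SignedPerm n) : Finset (Fin n) :=
  Finset.univ.filter fun a =>
    ∃ k, σ.1 (Letter.pos k) = Letter.pos a ∧ ∀ l, k < l → σ.val k < |σ.val l|

/-- The minimal absolute values in the balanced cycles of `π`, i.e. in the cycles of `π` on
`{±1, …, ±n}` that do not contain both a letter and its negative. -/
noncomputable def cyc₀ (π : SignedPerm n) : Finset (Fin n) :=
  Finset.univ.filter fun k =>
    ¬ π.1.SameCycle (Letter.pos k) (-Letter.pos k)
      ∧ ∀ x, π.1.SameCycle (Letter.pos k) x → (Letter.pos k).1 ≤ |x.1|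

/-- The minimal absolute values in the unbalanced cycles of `π`, i.e. in the cycles of `π` on
`{±1, …, ±n}` that contain a letter and its negative. -/
noncomputable def cyc₁ (π : SignedPerm n) : Finset (Fin n) :=
  Finset.univ.filter fun k =>
    π.1.SameCycle (Letter.pos k) (-Letter.pos k)
      ∧ ∀ x, π.1.SameCycle (Letter.pos k) x → (Letter.pos k).1 ≤ |x.1|

/-- `τ` is the transposition `(i j)`, where `0 < j` and `-j ≤ i < j`: it swaps `i` with `j` and
`-i` with `-j`; if `i = -j`, it just swaps `j` and `-j`. -/
def IsTransposition (i j : Letter n) (τ : SignedPerm n) : Prop :=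
  0 < j.1 ∧ -j.1 ≤ i.1 ∧ i.1 < j.1 ∧
    τ.1 = if i = -j then Equiv.swap i j else Equiv.swap i j * Equiv.swap (-i) (-j)

/-- The reflection length `ℓ'_B(σ)`: the minimal number of transpositions `(i j)`, `-j ≤ i < j`,
`0 < j`, whose product is `σ`. -/
noncomputable def reflectionLength (σ : SignedPerm n) : ℕ :=
  sInf {m | ∃ L : List (SignedPerm n),
    L.length = m ∧ (∀ τ ∈ L, ∃ i j, IsTransposition i j τ) ∧ L.prod = σ}

/-- `L = [(i₁, j₁, τ₁), …, (i_k, j_k, τ_k)]` is a factorization `σ = (i₁ j₁) ⋯ (i_k j_k)` into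
transpositions `τ_s = (i_s j_s)` with `j₁ < ⋯ < j_k`. -/
def IsSortingFactorization (σ : SignedPerm n)
    (L : List (Letter n × Letter n × SignedPerm n)) : Prop :=
  (∀ p ∈ L, IsTransposition p.1 p.2.1 p.2.2) ∧
    L.Pairwise (fun p p' => p.2.1.1 < p'.2.1.1) ∧ (L.map fun p => p.2.2).prod = σ

/-- The type `B_n` sorting index: `∑ (j_s - i_s - χ(i_s < 0))` over the unique factorization
`σ = (i₁ j₁) ⋯ (i_k j_k)` into transpositions with `j₁ < ⋯ < j_k`. -/
noncomputable def sorB (σ : SignedPerm n) : ℕ :=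
  sInf {w | ∃ L, IsSortingFactorization σ L ∧
    (w : ℤ) = (L.map fun p => p.2.1.1 - p.1.1 - if p.1.1 < 0 then 1 else 0).sum}

/-- The permutation `k ↦ |σ(k)|` of `{1, …, n}`. -/
def absPerm (σ : SignedPerm n) : Equiv.Perm (Fin n) where
  toFun k := (σ.1 (Letter.pos k)).idx
  invFun k := (σ.1.symm (Letter.pos k)).idx
  left_inv k := by
    have hs : ∀ x, σ.1 (-x) = -σ.1 x := σ.2
    have hi : ∀ x, σ.1.symm (-x) = -σ.1.symm x := (σ⁻¹).2
    rcases Letter.pos_idx (σ.1 (Letter.pos k)) with h | h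
    · simp only [h, Equiv.symm_apply_apply, Letter.idx_pos]
    · simp only [h, hi, Equiv.symm_apply_apply, Letter.idx_neg, Letter.idx_pos]
  right_inv k := by
    have hs : ∀ x, σ.1 (-x) = -σ.1 x := σ.2
    rcases Letter.pos_idx (σ.1.symm (Letter.pos k)) with h | h
    · simp only [h, Equiv.apply_symm_apply, Letter.idx_pos]
    · simp only [h, hs, Equiv.apply_symm_apply, Letter.idx_neg, Letter.idx_pos]

end SignedPerm

/-- The position, among the `2n` steps of the Dyck path `D(r)`, of the `k`-th rise (the vertex
`o_k`). The `i`-th fall of `D(r)` is preceded by exactly `r_i` rises, so the `k`-th rise is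
preceded by `k - 1` rises and by the falls `i` with `r_i < k`. -/
def opener {n : ℕ} (r : Fin n → ℕ) (k : Fin n) : ℕ :=
  (k + 1) + (Finset.univ.filter fun i => r i < k + 1).card

/-- The position, among the `2n` steps of the Dyck path `D(r)`, of the `i`-th fall (the vertex
`c_i`), which is preceded by `r_i` rises and `i - 1` falls. -/
def closer {n : ℕ} (r : Fin n → ℕ) (i : Fin n) : ℕ := r i + (i + 1)

/-- The height of the `k`-th rise of `D(r)`, i.e. the `y`-coordinate of its right endpoint: the
number `k` of rises up to this one minus the number of falls before it. (Whenever `r_i ≥ i` for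
all `i`, the falls in question have `i < k`, and `1 ≤ h_k ≤ k`.) -/
def height {n : ℕ} (r : Fin n → ℕ) (k : Fin n) : ℕ :=
  (k + 1) - (Finset.univ.filter fun i => r i < k + 1).card

/-- A bicolored matching between the openers `o_1, …, o_n` and the closers `c_1, …, c_n`: the arc
with opener `o_k` is `o_k · c_i` for `i = partner k`; it is red if `color k = 0` and blue if
`color k = 1`. -/
@[ext]
structure BicoloredMatching (n : ℕ) where
  partner : Equiv.Perm (Fin n)
  color : Fin n → ZMod 2

namespace BicoloredMatching

variable {n : ℕ}

/-- The step `M_k ↦ M_{k-1}` in sorting towards `M₀`. If `o_k` is joined to the same closer in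
`M = M_k` and in `M₀`, the arc at `o_k` becomes red. Otherwise let `o_l = M(M₀(o_k))`; the arcs
`o_k · M(o_k)` and `o_l · M₀(o_k)` are replaced by `o_k · M₀(o_k)` and `o_l · M(o_k)`, and
the color of `o_k` is added to the colors of `o_k` and `o_l`. -/
def sortStep (M₀ : BicoloredMatching n) (k : Fin n) (M : BicoloredMatching n) :
    BicoloredMatching n :=
  if M.partner k = M₀.partner k then
    { partner := M.partner, color := Function.update M.color k 0 }
  else
    let l := M.partner.symm (M₀.partner k)
    { partner := M.partner * Equiv.swap k l
      color := fun i => if i = k ∨ i = l then M.color i + M.color k else M.color i }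

/-- The matching obtained from `M` after `d` steps of sorting towards `M₀`, in which the openers
are processed from the largest to the smallest one. -/
def sortStage (M M₀ : BicoloredMatching n) : ℕ → BicoloredMatching n
  | 0 => M
  | d + 1 =>
    if h : d < n then sortStep M₀ (Fin.rev ⟨d, h⟩) (sortStage M M₀ d) else sortStage M M₀ d

/-- The number of closers `c > o_k` with `M₀(c) < o_k` which lie in `[M(o_k), M₀(o_k)]` if
`M(o_k) ≤ M₀(o_k)`, and outside `(M₀(o_k), M(o_k))` if `M₀(o_k) < M(o_k)`; here the type of the
matchings is `D(r)`. -/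
def sortCount (r : Fin n → ℕ) (M M₀ : BicoloredMatching n) (k : Fin n) : ℕ :=
  if closer r (M.partner k) ≤ closer r (M₀.partner k) then
    (Finset.univ.filter fun i =>
      opener r k < closer r i ∧
      closer r i ∈ Set.Icc (closer r (M.partner k)) (closer r (M₀.partner k)) ∧
      opener r (M₀.partner.symm i) < opener r k).card
  else
    (Finset.univ.filter fun i =>
      opener r k < closer r i ∧
      closer r i ∉ Set.Ioo (closer r (M₀.partner k)) (closer r (M.partner k)) ∧
      opener r (M₀.partner.symm i) < opener r k).card

/-- `sor_k(M, M₀)`, computed from `M_k`, the matching in which exactly the openers larger than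
`o_k` have been processed. (The number `2k - 1` reads `2 * k + 1` for indices starting at `0`.) -/
def sorAt (r : Fin n → ℕ) (M M₀ : BicoloredMatching n) (k : Fin n) : ℕ :=
  let Mk := sortStage M M₀ (Fin.rev k)
  if Mk.color k = 0 then sortCount r Mk M₀ k else 2 * k + 1 - sortCount r Mk M₀ k

/-- The sorting index of bicolored matchings of type `D(r)`. -/
def sor (r : Fin n → ℕ) (M M₀ : BicoloredMatching n) : ℕ := ∑ k, sorAt r M M₀ k

end BicoloredMatching

namespace SignedPerm

variable {n : ℕ}

/-- The bicolored matching with arcs `o_{|σ(k)|} · c_k`, red if `σ(k) > 0` and blue if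
`σ(k) < 0`. -/
def toMatching (σ : SignedPerm n) : BicoloredMatching n where
  partner := σ.absPerm.symm
  color a := if 0 < σ.val (σ.absPerm.symm a) then 0 else 1

/-- The sorting index `sor_r(σ, σ₀)` on `B_r`. -/
def sorR (r : Fin n → ℕ) (σ σ₀ : SignedPerm n) : ℕ :=
  BicoloredMatching.sor r σ.toMatching σ₀.toMatching

end SignedPerm

/-- The `q`-integer `[m]_q = 1 + q + ⋯ + q^(m-1)`. -/
def qInt {R : Type*} [CommRing R] (q : R) (m : ℕ) : R := ∑ i ∈ Finset.range m, q ^ i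

/-! Both families of statistics are encoded by independent choices, one for each letter, and each
letter contributes one factor of the product.

Sorting: the step at the letter `k` multiplies `σ` on the right by the signed transposition
exchanging the current signed position of `k` with its position in `σ₀`. On `π = σ * σ₀⁻¹` this
deletes `k`, the largest letter that may still move, from its cycle. Reversing the steps builds each
element of `B_r` exactly once from `σ₀`, with `2 * h_k` signed positions to choose from for `k`. The
term `b_k` depends on this choice only: `a_k` takes each value `0, …, h_k - 1` once for either sign.
Deletion does not change which smaller letters are balanced or unbalanced cycle minima, and `k` is
itself a balanced (unbalanced) minimum exactly when it is chosen at its `σ₀`-position with positive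
(negative) sign. This gives `sum_sorR_cycleWeight`, with separate weights for balanced minima,
unbalanced minima and all other letters.

Inversions: record for each letter its sign and the number `m < h_b` of letters of smaller absolute
value to its right. Then `inv_B` is a sum of terms `m` or `2b - 1 - m`, and the positive
right-to-left minima are the letters with positive sign and `m = 0`. The code is injective, and all
codes occur since the sorting formula at `1` counts `B_r`. This gives `sum_invB_prlminl`, with the
same factors.

The remaining statistics reduce to these: `ℓ'_B` is `n` minus the number of balanced cycles,
`nmin_B` is `n` minus the number of positive right-to-left minima, and `sor_B` is the sorting index
towards the identity. -/

/-! ### Letters, their signs and absolute values. -/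

namespace Letter

variable {n : ℕ}

instance : InvolutiveNeg (Letter n) where
  neg_neg _ := Subtype.ext (neg_neg _)

theorem val_neg (x : Letter n) : (-x).1 = -x.1 := rfl

theorem val_pos (k : Fin n) : (pos k).1 = (k : ℤ) + 1 := rfl

theorem val_ne_zero (x : Letter n) : x.1 ≠ 0 := (Finset.mem_erase.mp x.2).1

theorem natAbs_eq (x : Letter n) : x.1.natAbs = x.idx + 1 := by
  have h := x.val_ne_zero
  change _ = x.1.natAbs - 1 + 1
  omega

theorem abs_eq (x : Letter n) : |x.1| = (x.idx : ℤ) + 1 := by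
  rw [Int.abs_eq_natAbs, natAbs_eq]
  push_cast
  rfl

theorem neg_ne (x : Letter n) : -x ≠ x := by
  intro h
  have h1 := congrArg Subtype.val h
  rw [val_neg] at h1
  have := x.val_ne_zero
  omega

theorem self_ne_neg (x : Letter n) : x ≠ -x := (neg_ne x).symm

theorem idx_eq_iff {x y : Letter n} : x.idx = y.idx ↔ x = y ∨ x = -y := by
  constructor
  · intro h
    rcases pos_idx x with hx | hx <;> rcases pos_idx y with hy | hy <;> rw [h, hy] at hx
    · exact .inl hx.symm
    · exact .inr hx.symm
    · right; rw [hx, neg_neg]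
    · left; exact (neg_injective hx).symm
  · rintro (rfl | rfl)
    · rfl
    · exact idx_neg y

theorem eq_pos_idx {x : Letter n} (h : 0 < x.1) : x = pos x.idx := by
  rcases pos_idx x with hx | hx
  · exact hx.symm
  · have h1 := congrArg Subtype.val hx
    rw [val_neg, val_pos] at h1
    omega

theorem eq_neg_pos_idx {x : Letter n} (h : ¬ 0 < x.1) : x = -pos x.idx := by
  rcases pos_idx x with hx | hx
  · have h1 := congrArg Subtype.val hx
    rw [val_pos] at h1
    omega
  · rw [hx, neg_neg]

theorem pos_val_pos (k : Fin n) : 0 < (pos k).1 := by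
  rw [val_pos]; omega

theorem not_neg_pos_val_pos (k : Fin n) : ¬ 0 < (-pos k).1 := by
  rw [val_neg, val_pos]; omega

theorem idx_eq_iff_pos {x : Letter n} {k : Fin n} : x.idx = k ↔ x = pos k ∨ x = -pos k := by
  rw [← idx_eq_iff, idx_pos]

end Letter

/-! ### Signed permutations and signed transpositions. -/

namespace SignedPerm

open Letter

variable {n : ℕ}

theorem map_neg (σ : SignedPerm n) (x : Letter n) : σ.1 (-x) = -σ.1 x := σ.2 x

theorem mul_apply (σ τ : SignedPerm n) (x : Letter n) : (σ * τ).1 x = σ.1 (τ.1 x) := rfl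

theorem inv_apply_self (σ : SignedPerm n) (x : Letter n) : (σ⁻¹).1 (σ.1 x) = x :=
  σ.1.symm_apply_apply x

theorem apply_inv_self (σ : SignedPerm n) (x : Letter n) : σ.1 ((σ⁻¹).1 x) = x :=
  σ.1.apply_symm_apply x

theorem inv_apply_eq {σ : SignedPerm n} {x y : Letter n} : (σ⁻¹).1 y = x ↔ y = σ.1 x :=
  Equiv.symm_apply_eq σ.1

theorem ext_pos {σ τ : SignedPerm n} (h : ∀ k, σ.1 (pos k) = τ.1 (pos k)) : σ = τ := by
  apply Subtype.ext
  ext1 x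
  rcases pos_idx x with hx | hx
  · rw [← hx]; exact h _
  · have : x = -pos x.idx := by rw [hx, neg_neg]
    rw [this, map_neg, map_neg, h]

/-- The signed transposition that swaps `a` with `b` and `-a` with `-b`; it is the identity when
`a = b`. -/
def signedSwap (a b : Letter n) : SignedPerm n :=
  ⟨if a = -b then Equiv.swap a b else Equiv.swap a b * Equiv.swap (-a) (-b), by
    intro x
    split_ifs with h
    · subst h
      simp only [Equiv.swap_apply_def]
      split_ifs <;> simp_all [neg_eq_iff_eq_neg, self_ne_neg]
    · have h' : b ≠ -a := fun h' => h (by rw [h', neg_neg])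
      simp only [Equiv.Perm.mul_apply, Equiv.swap_apply_def]
      split_ifs <;> simp_all [neg_eq_iff_eq_neg, self_ne_neg]⟩

theorem signedSwap_left (a b : Letter n) : (signedSwap a b).1 a = b := by
  unfold signedSwap
  by_cases h : a = -b
  · simp [h]
  · have h1 : a ≠ -a := self_ne_neg a
    simp only [h, if_false, Equiv.Perm.mul_apply]
    rw [Equiv.swap_apply_of_ne_of_ne h1 h, Equiv.swap_apply_left]

theorem signedSwap_right (a b : Letter n) : (signedSwap a b).1 b = a := by
  unfold signedSwap
  by_cases h : a = -b
  · simp [h]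
  · have h1 : b ≠ -b := self_ne_neg b
    have h' : b ≠ -a := fun h' => h (by rw [h', neg_neg])
    simp only [h, if_false, Equiv.Perm.mul_apply]
    rw [Equiv.swap_apply_of_ne_of_ne h' h1, Equiv.swap_apply_right]

theorem signedSwap_of_idx_ne {a b x : Letter n} (ha : x.idx ≠ a.idx) (hb : x.idx ≠ b.idx) :
    (signedSwap a b).1 x = x := by
  rw [Ne, idx_eq_iff, not_or] at ha hb
  unfold signedSwap
  split_ifs with h
  · exact Equiv.swap_apply_of_ne_of_ne ha.1 hb.1
  · rw [Equiv.Perm.mul_apply, Equiv.swap_apply_of_ne_of_ne ha.2 hb.2,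
      Equiv.swap_apply_of_ne_of_ne ha.1 hb.1]

theorem signedSwap_self (a : Letter n) : signedSwap a a = 1 := by
  apply Subtype.ext
  unfold signedSwap
  simp [self_ne_neg]
  rfl

theorem signedSwap_mul_self (a b : Letter n) : signedSwap a b * signedSwap a b = 1 := by
  apply Subtype.ext
  ext1 x
  rw [mul_apply]
  change _ = x
  by_cases ha : x.idx = a.idx
  · rcases idx_eq_iff.mp ha with rfl | rfl
    · rw [signedSwap_left, signedSwap_right]
    · rw [map_neg, map_neg, signedSwap_left, signedSwap_right]
  by_cases hb : x.idx = b.idx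
  · rcases idx_eq_iff.mp hb with rfl | rfl
    · rw [signedSwap_right, signedSwap_left]
    · rw [map_neg, map_neg, signedSwap_right, signedSwap_left]
  rw [signedSwap_of_idx_ne ha hb, signedSwap_of_idx_ne ha hb]

theorem mul_signedSwap_cancel (σ : SignedPerm n) (a b : Letter n) :
    σ * signedSwap a b * signedSwap a b = σ := by
  rw [mul_assoc, signedSwap_mul_self, mul_one]

/-- Conjugation relabels the letters of a transposition. Applied to `σ₀⁻¹`, it turns an exchange of
positions in `σ` into an exchange of letters in `σ * σ₀⁻¹`. -/
theorem signedSwap_conj (σ : SignedPerm n) (a b : Letter n) :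
    signedSwap (σ.1 a) (σ.1 b) * σ = σ * signedSwap a b := by
  apply Subtype.ext
  ext1 x
  rw [mul_apply, mul_apply]
  have hσ : ∀ y z : Letter n, y.idx ≠ z.idx → (σ.1 y).idx ≠ (σ.1 z).idx := by
    intro y z h
    rw [Ne, idx_eq_iff, not_or] at h ⊢
    rw [← map_neg]
    exact ⟨fun h' => h.1 (σ.1.injective h'), fun h' => h.2 (σ.1.injective h')⟩
  by_cases ha : x.idx = a.idx
  · rcases idx_eq_iff.mp ha with rfl | rfl
    · rw [signedSwap_left, signedSwap_left]
    · rw [map_neg, map_neg, map_neg, signedSwap_left, signedSwap_left, map_neg]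
  by_cases hb : x.idx = b.idx
  · rcases idx_eq_iff.mp hb with rfl | rfl
    · rw [signedSwap_right, signedSwap_right]
    · rw [map_neg, map_neg, map_neg, signedSwap_right, signedSwap_right, map_neg]
  rw [signedSwap_of_idx_ne ha hb, signedSwap_of_idx_ne (hσ _ _ ha) (hσ _ _ hb)]

theorem isTransposition_signedSwap {i : Letter n} {k : Fin n} (hi : i.idx ≤ k) (hk : i ≠ pos k) :
    IsTransposition i (pos k) (signedSwap i (pos k)) := by
  have h1 := i.natAbs_eq
  have h2 : (i.idx : ℕ) ≤ k := hi
  have h3 : i.1 ≠ (k : ℤ) + 1 := fun h => hk (Subtype.ext h)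
  refine ⟨pos_val_pos k, ?_, ?_, rfl⟩ <;> rw [val_pos] <;> omega

theorem IsTransposition.eq_signedSwap {i j : Letter n} {τ : SignedPerm n}
    (h : IsTransposition i j τ) : τ = signedSwap i j :=
  Subtype.ext h.2.2.2

theorem IsTransposition.idx_le {i j : Letter n} {τ : SignedPerm n}
    (h : IsTransposition i j τ) : i.idx ≤ j.idx := by
  have h1 := i.natAbs_eq
  have h2 := j.natAbs_eq
  obtain ⟨h3, h4, h5, -⟩ := h
  change (i.idx : ℕ) ≤ j.idx
  omega

theorem idx_map_eq_iff (σ : SignedPerm n) {x y : Letter n} :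
    (σ.1 x).idx = (σ.1 y).idx ↔ x.idx = y.idx := by
  rw [idx_eq_iff, idx_eq_iff, ← map_neg, σ.1.injective.eq_iff, σ.1.injective.eq_iff]

theorem absPerm_idx (σ : SignedPerm n) (x : Letter n) : σ.absPerm x.idx = (σ.1 x).idx := by
  change (σ.1 (pos x.idx)).idx = _
  rw [idx_map_eq_iff, idx_pos]

theorem absPerm_symm_apply (σ : SignedPerm n) (k : Fin n) :
    σ.absPerm.symm k = ((σ⁻¹).1 (pos k)).idx := rfl

theorem absPerm_apply (σ : SignedPerm n) (k : Fin n) :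
    σ.absPerm k = (σ.1 (pos k)).idx := rfl

theorem abs_val (σ : SignedPerm n) (k : Fin n) : |σ.val k| = (σ.absPerm k : ℤ) + 1 :=
  abs_eq _

theorem mem_restricted {r : Fin n → ℕ} {σ : SignedPerm n} :
    σ ∈ restricted r ↔ ∀ k, (σ.absPerm k : ℕ) < r k := by
  unfold restricted
  rw [Finset.mem_filter]
  simp only [Finset.mem_univ, true_and, abs_val]
  refine forall_congr' fun k => ?_
  omega

end SignedPerm

/-! ### Cycles and the deletion of a letter. -/

/-- Lying in one cycle is the equivalence relation generated by `x ~ g x`. Claims about whole cycles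
thus reduce to a single application of `g`, for a well-chosen `E`. -/
theorem Equiv.Perm.SameCycle.rel_of_rel_apply {α : Type*} {g : Equiv.Perm α} (E : Setoid α)
    (h : ∀ x, E x (g x)) {x y : α} (hxy : g.SameCycle x y) : E x y := by
  obtain ⟨m, rfl⟩ := hxy
  induction m using Int.induction_on with
  | zero => exact E.refl x
  | succ m ih =>
    rw [add_comm, zpow_add, zpow_one]
    exact E.trans ih (h _)
  | pred m ih =>
    refine E.trans ih (E.symm ?_)
    have h1 := h ((g ^ (-(m : ℤ) - 1)) x)
    rwa [← Equiv.Perm.mul_apply, ← zpow_one_add, add_sub_cancel] at h1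

namespace SignedPerm

open Letter

variable {n : ℕ}

/-- The signed permutation fixes all letters with index at least `k`. -/
def FixesFrom (k : ℕ) (π : SignedPerm n) : Prop := ∀ j : Fin n, k ≤ j → π.1 (pos j) = pos j

section Deletion

variable {π : SignedPerm n} {i : Letter n} {k : Fin n}

theorem idx_apply_ne_of_fixed (hk : π.1 (pos k) = pos k) {x : Letter n} (hx : x.idx ≠ k) :
    (π.1 x).idx ≠ k := by
  intro h
  apply hx
  rw [← idx_pos k, ← hk, idx_map_eq_iff, idx_pos] at h
  exact h

theorem idx_apply_eq_of_fixed (hk : π.1 (pos k) = pos k) {x : Letter n} (hx : x.idx = k) :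
    π.1 x = x := by
  rcases idx_eq_iff_pos.mp hx with rfl | rfl
  · exact hk
  · rw [map_neg, hk]

/-- For `i ≠ ±k` the product inserts `k` right after `i` and `-k` right after `-i`, and for `i = ±k`
it affects only `±k`; the other letters keep their cycles. -/
theorem sameCycle_mul_signedSwap_iff (hk : π.1 (pos k) = pos k) {x y : Letter n}
    (hx : x.idx ≠ k) (hy : y.idx ≠ k) :
    (π * signedSwap i (pos k)).1.SameCycle x y ↔ π.1.SameCycle x y := by
  have hother : ∀ z : Letter n, z.idx ≠ i.idx → z.idx ≠ k →
      (π * signedSwap i (pos k)).1 z = π.1 z := by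
    intro z h1 h2
    rw [mul_apply, signedSwap_of_idx_ne h1 (by rwa [idx_pos])]
  have hi : (π * signedSwap i (pos k)).1 i = pos k := by
    rw [mul_apply, signedSwap_left, hk]
  have hpk : (π * signedSwap i (pos k)).1 (pos k) = π.1 i := by
    rw [mul_apply, signedSwap_right]
  have hii : (π * signedSwap i (pos k)).1 ((π * signedSwap i (pos k)).1 i) = π.1 i := by
    rw [hi, hpk]
  constructor
  · by_cases hik : i.idx = k
    · let φ : Letter n → Letter n := fun z => if z.idx = k then pos k else z
      intro h
      have := h.rel_of_rel_apply ((Equiv.Perm.SameCycle.setoid π.1).comap φ) (fun z => by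
        change π.1.SameCycle (φ z) (φ _)
        by_cases hz : z.idx = k
        · have : ((π * signedSwap i (pos k)).1 z).idx = k := by
            rw [(idx_map_eq_iff _).mpr (hz.trans hik.symm), hi, idx_pos]
          simp only [φ, hz, this, if_true]
          exact Equiv.Perm.SameCycle.refl _ _
        · rw [hother z (by rwa [hik]) hz]
          simp only [φ, hz, idx_apply_ne_of_fixed hk hz, if_false]
          exact ⟨1, by simp⟩)
      change π.1.SameCycle (φ x) (φ y) at this
      simpa only [φ, hx, hy, if_false] using this
    -- Each inserted letter is sent back to its predecessor, so that after `φ` a step of the product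
    -- is a step of `π` or no step at all.
    · let φ : Letter n → Letter n := fun z =>
        if z = pos k then i else if z = -pos k then -i else z
      have hφ : ∀ z : Letter n, z.idx ≠ k → φ z = z := by
        intro z hz
        rw [Ne, idx_eq_iff_pos, not_or] at hz
        simp only [φ, hz.1, hz.2, if_false]
      have hφk : φ (pos k) = i := by simp only [φ, if_true]
      have hφk' : φ (-pos k) = -i := by
        simp only [φ, neg_ne, if_true, if_false]
      intro h
      have := h.rel_of_rel_apply ((Equiv.Perm.SameCycle.setoid π.1).comap φ) (fun z => by
        change π.1.SameCycle (φ z) (φ _)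
        by_cases hz : z.idx = k
        · rcases idx_eq_iff_pos.mp hz with rfl | rfl
          · rw [hφk, hpk, hφ _ (idx_apply_ne_of_fixed hk hik)]
            exact ⟨1, by simp⟩
          · rw [hφk', map_neg, hpk, ← map_neg,
              hφ _ (idx_apply_ne_of_fixed hk (by rwa [idx_neg]))]
            exact ⟨1, by simp⟩
        · by_cases hzi : z.idx = i.idx
          · rcases idx_eq_iff.mp hzi with rfl | rfl
            · rw [hi, hφk, hφ _ hik]
            · rw [map_neg, hi, hφk', hφ _ (by rwa [idx_neg])]
          · rw [hother z hzi hz, hφ z hz, hφ _ (idx_apply_ne_of_fixed hk hz)]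
            exact ⟨1, by simp⟩)
      change π.1.SameCycle (φ x) (φ y) at this
      rwa [hφ x hx, hφ y hy] at this
  · intro h
    -- Conversely, a step of `π` from `±i` is two steps of the product, through `±k`; elsewhere it
    -- is one step, or none at `±k`.
    refine h.rel_of_rel_apply (Equiv.Perm.SameCycle.setoid _) (fun z => ?_)
    change (π * signedSwap i (pos k)).1.SameCycle z _
    by_cases hz : z.idx = k
    · rw [idx_apply_eq_of_fixed hk hz]
    · by_cases hzi : z.idx = i.idx
      · rcases idx_eq_iff.mp hzi with rfl | rfl
        · rw [← hii, Equiv.Perm.sameCycle_apply_right, Equiv.Perm.sameCycle_apply_right]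
        · rw [map_neg, ← hii, ← map_neg, ← map_neg, Equiv.Perm.sameCycle_apply_right,
            Equiv.Perm.sameCycle_apply_right]
      · rw [← hother z hzi hz]
        exact ⟨1, by simp⟩

/-- The inserted letters have absolute value larger than that of `j`, so they cannot violate its
minimality. -/
theorem minimal_mul_signedSwap_iff (hk : π.1 (pos k) = pos k) {j : Fin n} (hj : j < k) :
    (∀ x, (π * signedSwap i (pos k)).1.SameCycle (pos j) x → (pos j).1 ≤ |x.1|) ↔
      ∀ x, π.1.SameCycle (pos j) x → (pos j).1 ≤ |x.1| := by
  refine forall_congr' fun x => ?_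
  by_cases hx : x.idx = k
  · have : (pos j).1 ≤ |x.1| := by
      have h : (j : ℕ) < k := hj
      rw [abs_eq, val_pos, hx]
      omega
    simp only [this, implies_true]
  · rw [sameCycle_mul_signedSwap_iff hk (by rw [idx_pos]; exact hj.ne) hx]

theorem mem_cyc₀_mul_signedSwap_of_lt (hk : π.1 (pos k) = pos k) {j : Fin n} (hj : j < k) :
    j ∈ (π * signedSwap i (pos k)).cyc₀ ↔ j ∈ π.cyc₀ := by
  unfold cyc₀
  rw [Finset.mem_filter, Finset.mem_filter, minimal_mul_signedSwap_iff hk hj,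
    sameCycle_mul_signedSwap_iff hk (by rw [idx_pos]; exact hj.ne)
      (by rw [idx_neg, idx_pos]; exact hj.ne)]

theorem mem_cyc₁_mul_signedSwap_of_lt (hk : π.1 (pos k) = pos k) {j : Fin n} (hj : j < k) :
    j ∈ (π * signedSwap i (pos k)).cyc₁ ↔ j ∈ π.cyc₁ := by
  unfold cyc₁
  rw [Finset.mem_filter, Finset.mem_filter, minimal_mul_signedSwap_iff hk hj,
    sameCycle_mul_signedSwap_iff hk (by rw [idx_pos]; exact hj.ne)
      (by rw [idx_neg, idx_pos]; exact hj.ne)]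

theorem mem_cyc₀_of_fixed (hk : π.1 (pos k) = pos k) : k ∈ π.cyc₀ := by
  have h : ∀ x, π.1.SameCycle (pos k) x → x = pos k := by
    intro x hx
    obtain ⟨m, rfl⟩ := hx
    exact Equiv.Perm.zpow_apply_eq_self_of_apply_eq_self hk m
  unfold cyc₀
  rw [Finset.mem_filter]
  refine ⟨Finset.mem_univ _, fun h' => neg_ne _ (h _ h'), fun x hx => ?_⟩
  rw [h x hx]
  exact le_abs_self _

theorem mem_cyc₁_of_apply_eq_neg (hk : π.1 (pos k) = -pos k) : k ∈ π.cyc₁ := by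
  unfold cyc₁
  rw [Finset.mem_filter]
  refine ⟨Finset.mem_univ _, ⟨1, by simpa using hk⟩, fun x hx => ?_⟩
  -- Having absolute value `k` is preserved by `π`, so the cycle of `k` lies in `{k, -k}`.
  have := hx.rel_of_rel_apply ((⊥ : Setoid Prop).comap fun y => y.idx = k) (fun y => by
    change (y.idx = k) = ((π.1 y).idx = k)
    have h1 : (π.1 (pos k)).idx = k := by rw [hk, idx_neg, idx_pos]
    conv_rhs => rw [← h1]
    rw [idx_map_eq_iff, idx_pos])
  change ((pos k).idx = k) = (x.idx = k) at this
  rw [idx_pos] at this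
  rw [abs_eq, this.mp rfl, val_pos]

theorem not_mem_cyc₁_of_mem_cyc₀ (h : k ∈ π.cyc₀) : k ∉ π.cyc₁ := by
  unfold cyc₀ cyc₁ at *
  rw [Finset.mem_filter] at *
  exact fun h' => h.2.1 h'.2.1

theorem not_minimal_of_idx_lt (hi : π.1 i = pos k) (hik : i.idx < k) :
    k ∉ π.cyc₀ ∧ k ∉ π.cyc₁ := by
  have h : ¬ ∀ x, π.1.SameCycle (pos k) x → (pos k).1 ≤ |x.1| := by
    intro h
    have h1 := h i (Equiv.Perm.SameCycle.symm ⟨1, by simpa using hi⟩)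
    have h2 : (i.idx : ℕ) < k := hik
    rw [val_pos, abs_eq] at h1
    omega
  unfold cyc₀ cyc₁
  rw [Finset.mem_filter, Finset.mem_filter]
  exact ⟨fun h' => h h'.2.2, fun h' => h h'.2.2⟩

end Deletion

/-! ### Factorization by successive deletions. -/

theorem FixesFrom.apply_eq {k : ℕ} {π : SignedPerm n} (h : FixesFrom k π) {x : Letter n}
    (hx : k ≤ x.idx) : π.1 x = x :=
  idx_apply_eq_of_fixed (h x.idx hx) rfl

theorem FixesFrom.idx_inv_lt {k : ℕ} {π : SignedPerm n} (h : FixesFrom k π) {x : Letter n}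
    (hx : (x.idx : ℕ) < k) : (((π⁻¹).1 x).idx : ℕ) < k := by
  by_contra hc
  have h1 := h.apply_eq (not_lt.mp hc)
  rw [apply_inv_self] at h1
  rw [← h1] at hc
  exact hc hx

theorem FixesFrom.mono {k l : ℕ} {π : SignedPerm n} (h : FixesFrom k π) (hkl : k ≤ l) :
    FixesFrom l π := fun j hj => h j (hkl.trans hj)

theorem FixesFrom.eq_one {π : SignedPerm n} (h : FixesFrom 0 π) : π = 1 :=
  ext_pos fun k => h k (Nat.zero_le _)

theorem fixesFrom_of_le {k : ℕ} (hk : n ≤ k) (π : SignedPerm n) : FixesFrom k π :=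
  fun j hj => absurd j.2 (by omega)

theorem FixesFrom.one (k : ℕ) : FixesFrom k (1 : SignedPerm n) := fun _ _ => rfl

theorem FixesFrom.mul {k : ℕ} {π ρ : SignedPerm n} (h : FixesFrom k π) (h' : FixesFrom k ρ) :
    FixesFrom k (π * ρ) := fun j hj => by rw [mul_apply, h' j hj, h j hj]

theorem fixesFrom_signedSwap {k : Fin n} {i : Letter n} (hi : i.idx ≤ k) :
    FixesFrom (k + 1) (signedSwap i (pos k)) := by
  intro j hj
  have hi : (i.idx : ℕ) ≤ k := hi
  apply signedSwap_of_idx_ne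
  · rw [idx_pos]; exact fun h => absurd (congrArg Fin.val h) (by omega)
  · rw [idx_pos, idx_pos]; exact fun h => absurd (congrArg Fin.val h) (by omega)

theorem FixesFrom.succ_mul {k : Fin n} {π : SignedPerm n} (h : FixesFrom (k + 1) π)
    (h' : π.1 (pos k) = pos k) : FixesFrom k π := by
  intro j hj
  rcases hj.eq_or_lt with hj | hj
  · rw [← Fin.ext hj]; exact h'
  · exact h j hj

/-- Deleting the largest letter that is not fixed from its cycle. -/
theorem FixesFrom.delete {k : Fin n} {π : SignedPerm n} (h : FixesFrom (k + 1) π) :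
    ((π⁻¹).1 (pos k)).idx ≤ k ∧
      FixesFrom k (π * signedSwap ((π⁻¹).1 (pos k)) (pos k)) := by
  have hi : ((π⁻¹).1 (pos k)).idx ≤ k := by
    have := h.idx_inv_lt (x := pos k) (by rw [idx_pos]; omega)
    exact Fin.le_def.mpr (by omega)
  exact ⟨hi, (h.mul (fixesFrom_signedSwap hi)).succ_mul
    (by rw [mul_apply, signedSwap_right, apply_inv_self])⟩

/-- The fixed letter `k` is a balanced minimum; after insertion it either shares a cycle with a
smaller letter or, for `i = -k`, forms an unbalanced cycle. So each transposition costs exactly one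
balanced minimum. -/
theorem cyc₀_mul_signedSwap {k : Fin n} {π : SignedPerm n} {i : Letter n} (h : FixesFrom k π)
    (hi : i.idx ≤ k) (hik : i ≠ pos k) :
    insert k (π * signedSwap i (pos k)).cyc₀ = π.cyc₀ ∧ k ∉ (π * signedSwap i (pos k)).cyc₀ := by
  have hk := h k le_rfl
  have hpi : (π * signedSwap i (pos k)).1 i = pos k := by rw [mul_apply, signedSwap_left, hk]
  have hfix : FixesFrom (k + 1) (π * signedSwap i (pos k)) :=
    (h.mono (Nat.le_succ _)).mul (fixesFrom_signedSwap hi)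
  constructor
  · ext j
    rw [Finset.mem_insert]
    rcases lt_trichotomy j k with hj | rfl | hj
    · rw [mem_cyc₀_mul_signedSwap_of_lt hk hj]
      simp only [hj.ne, false_or]
    · simp only [true_or, mem_cyc₀_of_fixed hk]
    · simp only [mem_cyc₀_of_fixed (h j (le_of_lt hj)), mem_cyc₀_of_fixed (hfix j hj), or_true]
  · rcases hi.eq_or_lt with hi | hi
    · rcases idx_eq_iff_pos.mp hi with rfl | rfl
      · exact absurd rfl hik
      · refine fun h' => not_mem_cyc₁_of_mem_cyc₀ h' (mem_cyc₁_of_apply_eq_neg ?_)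
        rw [map_neg] at hpi
        exact neg_eq_iff_eq_neg.mp hpi
    · exact (not_minimal_of_idx_lt hpi hi).1

/-- Deleting the largest letter splits off the last factor, and only letters that are moved give a
factor; hence the length is `n` minus the number of balanced cycles. -/
theorem exists_sortingFactorization (k : ℕ) : ∀ π : SignedPerm n, FixesFrom k π →
    ∃ L, IsSortingFactorization π L ∧ (∀ p ∈ L, (p.2.1.idx : ℕ) < k) ∧
      L.length + π.cyc₀.card = n := by
  induction k with
  | zero =>
    intro π h
    refine ⟨[], ⟨by simp, by simp, by simp [h.eq_one]⟩, by simp, ?_⟩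
    have : π.cyc₀ = Finset.univ :=
      Finset.eq_univ_of_forall fun j => mem_cyc₀_of_fixed (h j (Nat.zero_le _))
    simp [this]
  | succ k ih =>
    intro π h
    by_cases hkn : k < n
    · obtain ⟨k, rfl⟩ : ∃ k' : Fin n, (k' : ℕ) = k := ⟨⟨k, hkn⟩, rfl⟩
      obtain ⟨hi, hπ'⟩ := h.delete
      by_cases hik : (π⁻¹).1 (pos k) = pos k
      · obtain ⟨L, hL, hlt, hlen⟩ := ih π
          (h.succ_mul (by rw [inv_apply_eq] at hik; exact hik.symm))
        exact ⟨L, hL, fun p hp => (hlt p hp).trans (Nat.lt_succ_self _), hlen⟩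
      · obtain ⟨L, ⟨hT, hP, hprod⟩, hlt, hlen⟩ := ih _ hπ'
        set i := (π⁻¹).1 (pos k)
        refine ⟨L ++ [(i, pos k, signedSwap i (pos k))], ⟨?_, ?_, ?_⟩, ?_, ?_⟩
        · intro p hp
          rcases List.mem_append.mp hp with hp | hp
          · exact hT p hp
          · rw [List.mem_singleton] at hp
            subst hp
            exact isTransposition_signedSwap hi hik
        · rw [List.pairwise_append]
          refine ⟨hP, List.pairwise_singleton _ _, fun p hp p' hp' => ?_⟩
          rw [List.mem_singleton] at hp'
          subst hp'
          have h1 := hlt p hp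
          have h2 := p.2.1.natAbs_eq
          have h3 := (hT p hp).1
          change p.2.1.1 < (pos k).1
          rw [val_pos]
          omega
        · rw [List.map_append, List.prod_append, hprod, List.map_singleton, List.prod_singleton,
            mul_signedSwap_cancel]
        · intro p hp
          rcases List.mem_append.mp hp with hp | hp
          · exact (hlt p hp).trans (Nat.lt_succ_self _)
          · rw [List.mem_singleton] at hp
            subst hp
            change ((pos k).idx : ℕ) < _
            rw [idx_pos]
            omega
        · obtain ⟨h1, h2⟩ := cyc₀_mul_signedSwap hπ' hi hik
          rw [mul_signedSwap_cancel] at h1 h2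
          rw [← h1, Finset.card_insert_of_notMem h2] at hlen
          rw [List.length_append, List.length_singleton]
          omega
    · obtain ⟨L, hL, hlt, hlen⟩ := ih π (fixesFrom_of_le (not_lt.mp hkn) π)
      exact ⟨L, hL, fun p hp => (hlt p hp).trans (Nat.lt_succ_self _), hlen⟩

/-! ### Reflection length by a dimension count. -/

/-- The odd extension to all letters of a function on the positive letters. -/
def oddExtend (w : Fin n → ℚ) (x : Letter n) : ℚ := if 0 < x.1 then w x.idx else -w x.idx

theorem oddExtend_pos (w : Fin n → ℚ) (k : Fin n) : oddExtend w (pos k) = w k := by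
  rw [oddExtend, if_pos (pos_val_pos k), idx_pos]

theorem oddExtend_neg (w : Fin n → ℚ) (x : Letter n) : oddExtend w (-x) = -oddExtend w x := by
  have h := x.val_ne_zero
  unfold oddExtend
  rw [idx_neg, val_neg]
  by_cases h0 : 0 < x.1
  · rw [if_pos h0, if_neg (by omega)]
  · rw [if_neg h0, if_pos (by omega), neg_neg]

theorem oddExtend_signedSwap {w : Fin n → ℚ} {i j : Letter n}
    (h : oddExtend w i = oddExtend w j) (x : Letter n) :
    oddExtend w ((signedSwap i j).1 x) = oddExtend w x := by
  by_cases hi : x.idx = i.idx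
  · rcases idx_eq_iff.mp hi with rfl | rfl
    · rw [signedSwap_left, h]
    · rw [map_neg, signedSwap_left, oddExtend_neg, oddExtend_neg, h]
  by_cases hj : x.idx = j.idx
  · rcases idx_eq_iff.mp hj with rfl | rfl
    · rw [signedSwap_right, h]
    · rw [map_neg, signedSwap_right, oddExtend_neg, oddExtend_neg, h]
  rw [signedSwap_of_idx_ne hi hj]

/-- An odd function constant on cycles equals its own negative on an unbalanced cycle, and on a
balanced one it is determined by its value at the minimum. -/
theorem eq_zero_of_oddExtend_invariant {π : SignedPerm n} {w : Fin n → ℚ}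
    (h : ∀ x, oddExtend w (π.1 x) = oddExtend w x) (h0 : ∀ k ∈ π.cyc₀, w k = 0) : w = 0 := by
  have hcyc : ∀ x y, π.1.SameCycle x y → oddExtend w x = oddExtend w y := fun x y hxy =>
    hxy.rel_of_rel_apply (Setoid.ker (oddExtend w)) fun z => (h z).symm
  have key : ∀ m : ℕ, ∀ k : Fin n, (k : ℕ) = m → w k = 0 := by
    intro m
    induction m using Nat.strong_induction_on with
    | _ m ih =>
      intro k hk
      by_cases hk0 : k ∈ π.cyc₀
      · exact h0 k hk0
      · unfold cyc₀ at hk0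
        rw [Finset.mem_filter] at hk0
        simp only [Finset.mem_univ, true_and, not_and_or, not_not, not_forall] at hk0
        rcases hk0 with hk0 | ⟨x, hx, hlt⟩
        · have := hcyc _ _ hk0
          rw [oddExtend_neg, oddExtend_pos] at this
          linarith
        · rw [abs_eq, val_pos] at hlt
          have h1 := hcyc _ _ hx
          have h2 := ih x.idx (by omega) x.idx rfl
          rw [oddExtend_pos, oddExtend, h2, neg_zero, ite_self] at h1
          exact h1
  funext k
  exact key k k rfl

/-- One linear equation `w(i) = w(j)` per factor makes `w` invariant under the product. Together
with the vanishing of `w` on `cyc₀` these equations force `w = 0`, so there are at least `n` of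
them. -/
theorem le_length_add_card_cyc₀ {L : List (SignedPerm n)}
    (hL : ∀ τ ∈ L, ∃ i j, IsTransposition i j τ) : n ≤ L.length + L.prod.cyc₀.card := by
  choose i j hij using fun s : Fin L.length => hL L[s] (List.getElem_mem _)
  let ψ : (Fin n → ℚ) →ₗ[ℚ] (Fin L.length → ℚ) × (L.prod.cyc₀ → ℚ) :=
    { toFun := fun w => (fun s => oddExtend w (i s) - oddExtend w (j s), fun k => w k)
      map_add' := fun v w => by
        ext s
        · simp only [oddExtend, Pi.add_apply, Prod.mk_add_mk]
          split_ifs <;> ring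
        · rfl
      map_smul' := fun c w => by
        ext s
        · simp only [oddExtend, Pi.smul_apply, smul_eq_mul, RingHom.id_apply, Prod.smul_mk]
          split_ifs <;> ring
        · rfl }
  have hψ : Function.Injective ψ := by
    rw [← LinearMap.ker_eq_bot, LinearMap.ker_eq_bot']
    intro w hw
    have h1 : ∀ s, oddExtend w (i s) = oddExtend w (j s) := fun s =>
      sub_eq_zero.mp (congrFun (congrArg Prod.fst hw) s)
    have h2 : ∀ k ∈ L.prod.cyc₀, w k = 0 := fun k hk =>
      congrFun (congrArg Prod.snd hw) ⟨k, hk⟩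
    refine eq_zero_of_oddExtend_invariant (π := L.prod) ?_ h2
    have h3 : ∀ τ ∈ L, ∀ x, oddExtend w (τ.1 x) = oddExtend w x := by
      intro τ hτ x
      obtain ⟨s, hs, rfl⟩ := List.getElem_of_mem hτ
      have := (hij ⟨s, hs⟩).eq_signedSwap
      change L[s] = _ at this
      rw [this]
      exact oddExtend_signedSwap (h1 _) x
    clear * - h3
    induction L with
    | nil => intro x; rfl
    | cons τ L ih =>
      intro x
      rw [List.prod_cons, mul_apply, h3 τ List.mem_cons_self,
        ih fun τ' h' => h3 τ' (List.mem_cons_of_mem _ h')]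
  have := LinearMap.finrank_le_finrank_of_injective hψ
  simpa [Module.finrank_prod] using this

theorem reflectionLength_add_card_cyc₀ (π : SignedPerm n) :
    π.reflectionLength + π.cyc₀.card = n := by
  obtain ⟨L, ⟨hT, -, hprod⟩, -, hlen⟩ :=
    exists_sortingFactorization n π (fixesFrom_of_le le_rfl π)
  have hmem : L.length ∈ {m | ∃ L : List (SignedPerm n),
      L.length = m ∧ (∀ τ ∈ L, ∃ i j, IsTransposition i j τ) ∧ L.prod = π} := by
    refine ⟨L.map fun p => p.2.2, List.length_map _, fun τ hτ => ?_, hprod⟩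
    obtain ⟨p, hp, rfl⟩ := List.mem_map.mp hτ
    exact ⟨_, _, hT p hp⟩
  have h1 : π.reflectionLength ≤ L.length := Nat.sInf_le hmem
  obtain ⟨L', hL', hT', hprod'⟩ := Nat.sInf_mem ⟨_, hmem⟩
  have h2 := le_length_add_card_cyc₀ hT'
  rw [hprod', hL'] at h2
  change n ≤ π.reflectionLength + _ at h2
  omega

/-! ### Right-to-left minima and `nmin_B`. -/

theorem mem_prlminl {σ : SignedPerm n} {a : Fin n} :
    a ∈ σ.prlminl ↔
      ∃ k, σ.1 (pos k) = pos a ∧ ∀ l, k < l → σ.absPerm k < σ.absPerm l := by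
  unfold prlminl
  rw [Finset.mem_filter]
  simp only [Finset.mem_univ, true_and, abs_val]
  refine exists_congr fun k => and_congr_right fun h => forall_congr' fun l =>
    imp_congr_right fun _ => ?_
  have h1 : σ.val k = (a : ℤ) + 1 := congrArg Subtype.val h
  have h2 : σ.absPerm k = a := by rw [absPerm_apply, h, idx_pos]
  rw [h1, h2, Fin.lt_def]
  omega

theorem val_ne_zero (σ : SignedPerm n) (k : Fin n) : σ.val k ≠ 0 := Letter.val_ne_zero _

/-- The positions split into the negative ones, the positive ones with a smaller absolute value to
the right, and the positive right-to-left minima. -/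
theorem nminB_add_card_prlminl (σ : SignedPerm n) : σ.nminB + σ.prlminl.card = n := by
  have h1 : σ.prlminl.card
      = (Finset.univ.filter fun k => 0 < σ.val k ∧ ∀ l, k < l → σ.val k < |σ.val l|).card := by
    symm
    refine Finset.card_nbij σ.absPerm ?_ σ.absPerm.injective.injOn ?_
    · intro k hk
      rw [Finset.mem_coe, Finset.mem_filter] at hk
      unfold prlminl
      rw [Finset.mem_coe, Finset.mem_filter]
      exact ⟨Finset.mem_univ _, k, eq_pos_idx hk.2.1, hk.2.2⟩
    · intro a ha
      unfold prlminl at ha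
      rw [Finset.mem_coe, Finset.mem_filter] at ha
      obtain ⟨-, k, hk, hmin⟩ := ha
      refine ⟨k, ?_, by rw [absPerm_apply, hk, idx_pos]⟩
      rw [Finset.mem_coe, Finset.mem_filter]
      refine ⟨Finset.mem_univ _, ?_, hmin⟩
      unfold val
      rw [hk]
      exact pos_val_pos a
  have h2 : (Finset.univ : Finset (Fin n)).card = n := by simp
  conv_rhs => rw [← h2]
  rw [h1, nminB, numNeg, ← Finset.card_union_of_disjoint, ← Finset.card_union_of_disjoint]
  · congr 1
    refine Finset.eq_univ_of_forall fun k => ?_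
    simp only [Finset.mem_union, Finset.mem_filter, Finset.mem_univ, true_and]
    have h0 := σ.val_ne_zero k
    by_cases hk : 0 < σ.val k
    · by_cases hmin : ∀ l, k < l → σ.val k < |σ.val l|
      · exact .inr ⟨hk, hmin⟩
      · push Not at hmin
        obtain ⟨l, hl, hle⟩ := hmin
        refine .inl (.inl ⟨l, hl, lt_of_le_of_ne hle fun h => hl.ne ?_⟩)
        rw [← abs_of_pos hk, abs_val, abs_val] at h
        exact σ.absPerm.injective (Fin.ext (by omega))
    · exact .inl (.inr (by omega))
  · rw [Finset.disjoint_left]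
    intro k hk hk'
    simp only [Finset.mem_union, Finset.mem_filter, Finset.mem_univ, true_and] at hk hk'
    rcases hk with ⟨l, hl, hlt⟩ | hk
    · have := hk'.2 l hl
      omega
    · omega
  · rw [Finset.disjoint_left]
    intro k hk hk'
    simp only [Finset.mem_filter, Finset.mem_univ, true_and] at hk hk'
    obtain ⟨l, -, hlt⟩ := hk
    have := abs_nonneg (σ.val l)
    omega

/-! ### Sorting matchings as multiplication by transpositions. -/

theorem signedSwap_inv (a b : Letter n) : (signedSwap a b)⁻¹ = signedSwap a b :=
  inv_eq_of_mul_eq_one_right (signedSwap_mul_self a b)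

theorem toMatching_partner (σ : SignedPerm n) (a : Fin n) :
    σ.toMatching.partner a = ((σ⁻¹).1 (pos a)).idx := rfl

/-- By oddness, the sign of `σ` at the position holding `±a` is the sign of `σ⁻¹(a)`. So the arc at
`o_a` encodes the signed position `σ⁻¹(a)`. -/
theorem toMatching_color (σ : SignedPerm n) (a : Fin n) :
    σ.toMatching.color a = if 0 < ((σ⁻¹).1 (pos a)).1 then 0 else 1 := by
  change (if 0 < (σ.1 (pos ((σ⁻¹).1 (pos a)).idx)).1 then (0 : ZMod 2) else 1) = _
  by_cases h : 0 < ((σ⁻¹).1 (pos a)).1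
  · rw [← eq_pos_idx h, apply_inv_self, if_pos (pos_val_pos a), if_pos h]
  · rw [(neg_eq_iff_eq_neg.mpr (eq_neg_pos_idx h)).symm, map_neg, apply_inv_self, if_neg (not_neg_pos_val_pos a), if_neg h]

theorem inv_pos_of_pos {σ₀ : SignedPerm n} (hpos : ∀ k, 0 < σ₀.val k) (k : Fin n) :
    (σ₀⁻¹).1 (pos k) = pos (σ₀.absPerm.symm k) := by
  rw [inv_apply_eq, eq_comm]
  have h := eq_pos_idx (hpos (σ₀.absPerm.symm k))
  rw [← absPerm_apply, Equiv.apply_symm_apply] at h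
  exact h

/-- One step of sorting `σ` towards `σ₀`, on the level of signed permutations. -/
def sortMove (σ₀ : SignedPerm n) (k : Fin n) (σ : SignedPerm n) : SignedPerm n :=
  σ * signedSwap ((σ⁻¹).1 (pos k)) ((σ₀⁻¹).1 (pos k))

theorem sortMove_inv_apply (σ₀ : SignedPerm n) (k : Fin n) (σ : SignedPerm n) (x : Letter n) :
    ((sortMove σ₀ k σ)⁻¹).1 x =
      (signedSwap ((σ⁻¹).1 (pos k)) ((σ₀⁻¹).1 (pos k))).1 ((σ⁻¹).1 x) := by
  rw [sortMove, mul_inv_rev, signedSwap_inv, mul_apply]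

theorem sortMove_eq_self {σ₀ σ : SignedPerm n} {k : Fin n}
    (h : (σ⁻¹).1 (pos k) = (σ₀⁻¹).1 (pos k)) : sortMove σ₀ k σ = σ := by
  rw [sortMove, h, signedSwap_self, mul_one]

/-- The letter `k` moves to its `σ₀`-position, which is positive by `hpos`. The letter `l` that was
there moves to the old position of `k` and its sign is multiplied by that of `k`, which is addition
of colors modulo `2`. -/
theorem toMatching_sortMove {σ₀ : SignedPerm n} (hpos : ∀ k, 0 < σ₀.val k) (k : Fin n)
    (σ : SignedPerm n) :
    (sortMove σ₀ k σ).toMatching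
      = BicoloredMatching.sortStep σ₀.toMatching k σ.toMatching := by
  have hz : (σ₀⁻¹).1 (pos k) = pos (σ₀.toMatching.partner k) := inv_pos_of_pos hpos k
  set p₀ := σ₀.toMatching.partner k with hp₀
  have hk : ((sortMove σ₀ k σ)⁻¹).1 (pos k) = pos p₀ := by
    rw [sortMove_inv_apply, signedSwap_left, hz]
  have hidx : ∀ a b : Fin n,
      ((σ⁻¹).1 (pos a)).idx = ((σ⁻¹).1 (pos b)).idx → a = b := fun a b h => by
    rwa [idx_map_eq_iff, idx_pos, idx_pos] at h
  have hother : ∀ a, a ≠ k → σ.toMatching.partner a ≠ p₀ →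
      ((sortMove σ₀ k σ)⁻¹).1 (pos a) = (σ⁻¹).1 (pos a) := by
    intro a ha ha'
    rw [sortMove_inv_apply, signedSwap_of_idx_ne (fun h => ha (hidx _ _ h))]
    rw [hz, idx_pos]
    exact ha'
  unfold BicoloredMatching.sortStep
  rw [← hp₀]
  split_ifs with hcase
  -- Here the transposition is trivial or only changes the sign of `k`, so no other arc is affected.
  · have hother' : ∀ a, a ≠ k → ((sortMove σ₀ k σ)⁻¹).1 (pos a) = (σ⁻¹).1 (pos a) := by
      intro a ha
      refine hother a ha fun h => ha ?_
      rw [← hcase] at h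
      exact σ.toMatching.partner.injective h
    apply BicoloredMatching.ext
    · ext1 a
      by_cases ha : a = k
      · rw [ha, toMatching_partner, hk, idx_pos, hcase]
      · rw [toMatching_partner, hother' a ha, toMatching_partner]
    · funext a
      change _ = Function.update σ.toMatching.color k 0 a
      by_cases ha : a = k
      · rw [ha, toMatching_color, hk, if_pos (pos_val_pos _), Function.update_self]
      · rw [toMatching_color, hother' a ha, Function.update_of_ne ha, toMatching_color]
  · set l := σ.toMatching.partner.symm p₀ with hl
    have hl' : σ.toMatching.partner l = p₀ := Equiv.apply_symm_apply _ _
    have hlk : l ≠ k := fun h => hcase (h ▸ hl')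
    have hother' : ∀ a, a ≠ k → a ≠ l →
        ((sortMove σ₀ k σ)⁻¹).1 (pos a) = (σ⁻¹).1 (pos a) := by
      intro a ha hal
      refine hother a ha fun h => hal ?_
      rw [← hl'] at h
      exact σ.toMatching.partner.injective h
    have hlval : (σ⁻¹).1 (pos l) = pos p₀ ∨ (σ⁻¹).1 (pos l) = -pos p₀ := by
      rw [← idx_eq_iff_pos]
      exact hl'
    apply BicoloredMatching.ext
    · ext1 a
      change _ = σ.toMatching.partner (Equiv.swap k l a)
      by_cases ha : a = k
      · rw [ha, toMatching_partner, hk, idx_pos, Equiv.swap_apply_left, hl']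
      by_cases hal : a = l
      · rw [hal, Equiv.swap_apply_right, toMatching_partner, toMatching_partner,
          sortMove_inv_apply, hz]
        rcases hlval with h | h
        · rw [h, signedSwap_right]
        · rw [h, map_neg, signedSwap_right, idx_neg]
      · rw [Equiv.swap_apply_of_ne_of_ne ha hal, toMatching_partner, hother' a ha hal,
          toMatching_partner]
    · funext a
      by_cases ha : a = k
      · simp only [ha, true_or, if_true]
        rw [toMatching_color, hk, if_pos (pos_val_pos _), CharTwo.add_self_eq_zero]
      by_cases hal : a = l
      · simp only [hal, or_true, if_true]
        rw [toMatching_color, toMatching_color σ l, toMatching_color σ k, sortMove_inv_apply, hz]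
        have h0 := ((σ⁻¹).1 (pos k)).val_ne_zero
        rcases hlval with h | h
        · rw [h, signedSwap_right, if_pos (pos_val_pos _), zero_add]
        · rw [h, map_neg, signedSwap_right, if_neg (not_neg_pos_val_pos _), val_neg]
          by_cases h1 : 0 < ((σ⁻¹).1 (pos k)).1
          · rw [if_pos h1, if_neg (by omega), add_zero]
          · rw [if_neg h1, if_pos (by omega), CharTwo.add_self_eq_zero]
      · simp only [ha, hal, or_self, if_false]
        rw [toMatching_color, hother' a ha hal, toMatching_color]

theorem fixesFrom_mul_inv_iff {σ σ₀ : SignedPerm n} {k : ℕ} :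
    FixesFrom k (σ * σ₀⁻¹) ↔ ∀ j : Fin n, k ≤ j → (σ⁻¹).1 (pos j) = (σ₀⁻¹).1 (pos j) := by
  refine forall_congr' fun j => imp_congr_right fun _ => ?_
  rw [mul_apply, inv_apply_eq, eq_comm]

theorem sortMove_mul_inv (σ σ₀ : SignedPerm n) (k : Fin n) :
    sortMove σ₀ k σ * σ₀⁻¹
      = σ * σ₀⁻¹ * signedSwap (((σ * σ₀⁻¹)⁻¹).1 (pos k)) (pos k) := by
  rw [mul_assoc, ← signedSwap_conj, sortMove, mul_assoc]
  congr 3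
  rw [mul_inv_rev, inv_inv, mul_apply, inv_apply_self]

theorem fixesFrom_sortMove {σ σ₀ : SignedPerm n} {k : Fin n}
    (h : FixesFrom (k + 1) (σ * σ₀⁻¹)) : FixesFrom k (sortMove σ₀ k σ * σ₀⁻¹) := by
  rw [sortMove_mul_inv]
  exact h.delete.2

section Stages

variable {σ₀ : SignedPerm n}

/-- The first `d` steps treat only letters of index at least `n - d ≥ k`, all of which are already
in place. -/
theorem sortStage_toMatching_of_fixesFrom (hpos : ∀ k, 0 < σ₀.val k) {σ : SignedPerm n} {k : ℕ}
    (h : FixesFrom k (σ * σ₀⁻¹)) :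
    ∀ d, d + k ≤ n → BicoloredMatching.sortStage σ.toMatching σ₀.toMatching d = σ.toMatching := by
  rw [fixesFrom_mul_inv_iff] at h
  intro d
  induction d with
  | zero => intro _; rfl
  | succ d ih =>
    intro hd
    rw [BicoloredMatching.sortStage, dif_pos (by omega), ih (by omega),
      ← toMatching_sortMove hpos, sortMove_eq_self (h _ _)]
    rw [Fin.val_rev]
    change k ≤ n - (d + 1)
    omega

/-- After `n - k` steps exactly the letters of index at least `k` have been treated. From then on,
sorting `σ` and sorting `sortMove σ₀ k σ` are the same process. -/
theorem sortStage_sortMove (hpos : ∀ k, 0 < σ₀.val k) {σ : SignedPerm n} {k : Fin n}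
    (h : FixesFrom (k + 1) (σ * σ₀⁻¹)) (d : ℕ) :
    BicoloredMatching.sortStage σ.toMatching σ₀.toMatching (n - k + d)
      = BicoloredMatching.sortStage (sortMove σ₀ k σ).toMatching σ₀.toMatching (n - k + d) := by
  have hk := k.2
  induction d with
  | zero =>
    rw [add_zero, sortStage_toMatching_of_fixesFrom hpos (fixesFrom_sortMove h) _ (by omega)]
    obtain ⟨m, hm⟩ : ∃ m, n - (k : ℕ) = m + 1 := ⟨n - k - 1, by omega⟩
    rw [hm, BicoloredMatching.sortStage, dif_pos (by omega),
      sortStage_toMatching_of_fixesFrom hpos h _ (by omega), toMatching_sortMove hpos]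
    congr 1
    apply Fin.ext
    rw [Fin.val_rev]
    change n - (m + 1) = k
    omega
  | succ d ih =>
    rw [← add_assoc, BicoloredMatching.sortStage, BicoloredMatching.sortStage, ih]

end Stages

/-! ### Dyck path vertices, cyclic ranks and the sorting index. -/

theorem closer_strictMono {r : Fin n → ℕ} (hr : Monotone r) : StrictMono (closer r) := by
  intro a b hab
  have h1 := hr hab.le
  have h2 : (a : ℕ) < b := hab
  unfold closer
  omega

theorem opener_strictMono (r : Fin n → ℕ) : StrictMono (opener r) := by
  intro a b hab
  have h2 : (a : ℕ) < b := hab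
  have h1 : (Finset.univ.filter fun i => r i < a + 1).card
      ≤ (Finset.univ.filter fun i => r i < b + 1).card := by
    refine Finset.card_le_card fun i hi => ?_
    rw [Finset.mem_filter] at hi ⊢
    exact ⟨hi.1, by omega⟩
  unfold opener
  omega

/-- If `k < r i`, monotonicity puts all falls before the `k`-th rise among those before the `i`-th
fall; otherwise the `i`-th fall and all earlier ones precede that rise. -/
theorem opener_lt_closer_iff {r : Fin n → ℕ} (hr : Monotone r) (k i : Fin n) :
    opener r k < closer r i ↔ (k : ℕ) < r i := by
  unfold opener closer
  by_cases h : (k : ℕ) < r i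
  · have h1 : (Finset.univ.filter fun j => r j < k + 1).card ≤ (Finset.Iio i).card := by
      refine Finset.card_le_card fun j hj => ?_
      rw [Finset.mem_filter] at hj
      rw [Finset.mem_Iio]
      by_contra hij
      have := hr (not_lt.mp hij)
      omega
    rw [Fin.card_Iio] at h1
    simp only [h, iff_true]
    omega
  · have h1 : (Finset.Iic i).card ≤ (Finset.univ.filter fun j => r j < k + 1).card := by
      refine Finset.card_le_card fun j hj => ?_
      rw [Finset.mem_Iic] at hj
      rw [Finset.mem_filter]
      have := hr hj
      exact ⟨Finset.mem_univ _, by omega⟩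
    rw [Fin.card_Iic] at h1
    simp only [h, iff_false]
    omega

/-- The number of elements of `S` met when moving up cyclically from `p` to `p₀`. -/
def cyclicRank (S : Finset (Fin n)) (p₀ p : Fin n) : ℕ :=
  if p ≤ p₀ then (S.filter fun i => p ≤ i ∧ i ≤ p₀).card
  else (S.filter fun i => ¬ (p₀ < i ∧ i < p)).card

theorem cyclicRank_self {S : Finset (Fin n)} {p₀ : Fin n} (h : p₀ ∉ S) :
    cyclicRank S p₀ p₀ = 0 := by
  rw [cyclicRank, if_pos le_rfl, Finset.card_eq_zero, Finset.filter_eq_empty_iff]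
  rintro i hi ⟨h1, h2⟩
  exact h (le_antisymm h1 h2 ▸ hi)

theorem cyclicRank_mem_Icc {S : Finset (Fin n)} {p₀ p : Fin n} (hp : p ∈ S) :
    cyclicRank S p₀ p ∈ Finset.Icc 1 S.card := by
  unfold cyclicRank
  rw [Finset.mem_Icc]
  split_ifs with h
  · exact ⟨Finset.card_pos.mpr ⟨p, Finset.mem_filter.mpr ⟨hp, le_rfl, h⟩⟩,
      Finset.card_filter_le _ _⟩
  · exact ⟨Finset.card_pos.mpr ⟨p, Finset.mem_filter.mpr ⟨hp, fun h' => lt_irrefl _ h'.2⟩⟩,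
      Finset.card_filter_le _ _⟩

/-- The sets counted for different elements of `S` are strictly nested: starting cyclically further
below `p₀` adds at least the new starting point. -/
theorem cyclicRank_injOn {S : Finset (Fin n)} {p₀ : Fin n} (h₀ : p₀ ∉ S) :
    Set.InjOn (cyclicRank S p₀) S := by
  have key : ∀ p ∈ S, ∀ p' ∈ S, p < p' → cyclicRank S p₀ p ≠ cyclicRank S p₀ p' := by
    intro p hp p' hp' hlt
    have hne : p ≠ p₀ := fun h => h₀ (h ▸ hp)
    have hne' : p' ≠ p₀ := fun h => h₀ (h ▸ hp')
    unfold cyclicRank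
    by_cases h : p ≤ p₀
    · rw [if_pos h]
      by_cases h' : p' ≤ p₀
      · rw [if_pos h']
        refine (Finset.card_lt_card ?_).ne'
        rw [Finset.ssubset_iff_of_subset]
        · exact ⟨p, Finset.mem_filter.mpr ⟨hp, le_rfl, h⟩, fun hm =>
            absurd (Finset.mem_filter.mp hm).2.1 (not_le.mpr hlt)⟩
        · intro i hi
          rw [Finset.mem_filter] at hi ⊢
          exact ⟨hi.1, hlt.le.trans hi.2.1, hi.2.2⟩
      · rw [if_neg h']
        refine (Finset.card_lt_card ?_).ne
        rw [Finset.ssubset_iff_of_subset]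
        · exact ⟨p', Finset.mem_filter.mpr ⟨hp', fun h' => lt_irrefl _ h'.2⟩, fun hm =>
            absurd (Finset.mem_filter.mp hm).2.2 h'⟩
        · intro i hi
          rw [Finset.mem_filter] at hi ⊢
          exact ⟨hi.1, fun h'' => not_lt.mpr hi.2.2 h''.1⟩
    · have h' : ¬ p' ≤ p₀ := fun h' => h (hlt.le.trans h')
      rw [if_neg h, if_neg h']
      refine (Finset.card_lt_card ?_).ne'
      rw [Finset.ssubset_iff_of_subset]
      · exact ⟨p, Finset.mem_filter.mpr ⟨hp, fun h' => lt_irrefl _ h'.2⟩, fun hm =>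
          (Finset.mem_filter.mp hm).2 ⟨not_le.mp h, hlt⟩⟩
      · intro i hi
        rw [Finset.mem_filter] at hi ⊢
        exact ⟨hi.1, fun h'' => hi.2 ⟨h''.1, h''.2.trans hlt⟩⟩
  intro p hp p' hp' h
  rcases lt_trichotomy p p' with hlt | rfl | hlt
  · exact absurd h (key p hp p' hp' hlt)
  · rfl
  · exact absurd h.symm (key p' hp' p hp hlt)

/-- The rank is injective on `S` with values in `{1, …, |S|}`, hence takes each of these values
once. -/
theorem sum_cyclicRank {R : Type*} [AddCommMonoid R] {S : Finset (Fin n)} {p₀ : Fin n}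
    (h₀ : p₀ ∉ S) (f : ℕ → R) :
    ∑ p ∈ S, f (cyclicRank S p₀ p) = ∑ i ∈ Finset.range S.card, f (i + 1) := by
  have himg : S.image (cyclicRank S p₀) = Finset.Icc 1 S.card := by
    refine Finset.eq_of_subset_of_card_le ?_ ?_
    · intro m hm
      obtain ⟨p, hp, rfl⟩ := Finset.mem_image.mp hm
      exact cyclicRank_mem_Icc hp
    · rw [Finset.card_image_of_injOn (cyclicRank_injOn h₀), Nat.card_Icc, Nat.add_sub_cancel]
  rw [← Finset.sum_image (cyclicRank_injOn h₀), himg, ← Finset.Ico_add_one_right_eq_Icc,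
    Finset.sum_Ico_eq_sum_range]
  simp only [Nat.add_sub_cancel, add_comm]

/-- The positions that can hold a letter smaller than `k` and can be exchanged with the final
position of `k` when `k` is sorted. -/
def openPositions (r : Fin n → ℕ) (σ₀ : SignedPerm n) (k : Fin n) : Finset (Fin n) :=
  Finset.univ.filter fun i => (k : ℕ) < r i ∧ σ₀.absPerm i < k

theorem sortCount_eq {r : Fin n → ℕ} (hr : Monotone r) (σ σ₀ : SignedPerm n) (k : Fin n) :
    BicoloredMatching.sortCount r σ.toMatching σ₀.toMatching k
      = cyclicRank (openPositions r σ₀ k) (σ₀.absPerm.symm k) ((σ⁻¹).1 (pos k)).idx := by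
  have hc := closer_strictMono hr
  have hs : ∀ i, σ₀.toMatching.partner.symm i = σ₀.absPerm i := fun i => rfl
  have hp : σ.toMatching.partner k = ((σ⁻¹).1 (pos k)).idx := rfl
  have hp₀ : σ₀.toMatching.partner k = σ₀.absPerm.symm k := rfl
  unfold BicoloredMatching.sortCount cyclicRank openPositions
  rw [hp, hp₀]
  simp only [Finset.filter_filter, opener_lt_closer_iff hr, hs, (opener_strictMono r).lt_iff_lt,
    Set.mem_Icc, Set.mem_Ioo, hc.le_iff_le, hc.lt_iff_lt]
  split_ifs <;> · congr 1; ext i; simp only [Finset.mem_filter]; tauto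

theorem symm_notMem_openPositions (r : Fin n → ℕ) (σ₀ : SignedPerm n) (k : Fin n) :
    σ₀.absPerm.symm k ∉ openPositions r σ₀ k := by
  unfold openPositions
  rw [Finset.mem_filter, Equiv.apply_symm_apply]
  exact fun h => lt_irrefl _ h.2.2

/-- The contribution of the letter `k` to the sorting index, when it is at the signed position
`y` before it is sorted. -/
def sortWeight (r : Fin n → ℕ) (σ₀ : SignedPerm n) (k : Fin n) (y : Letter n) : ℕ :=
  if 0 < y.1 then cyclicRank (openPositions r σ₀ k) (σ₀.absPerm.symm k) y.idx
  else 2 * k + 1 - cyclicRank (openPositions r σ₀ k) (σ₀.absPerm.symm k) y.idx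

theorem sorAt_eq_sortWeight {r : Fin n → ℕ} (hr : Monotone r) {σ₀ : SignedPerm n}
    (hpos : ∀ k, 0 < σ₀.val k) {σ : SignedPerm n} {k : Fin n}
    (h : FixesFrom (k + 1) (σ * σ₀⁻¹)) :
    BicoloredMatching.sorAt r σ.toMatching σ₀.toMatching k
      = sortWeight r σ₀ k ((σ⁻¹).1 (pos k)) := by
  unfold BicoloredMatching.sorAt sortWeight
  have hk := k.2
  rw [sortStage_toMatching_of_fixesFrom hpos h _ (by rw [Fin.val_rev]; omega)]
  simp only [sortCount_eq hr, toMatching_color]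
  split_ifs <;> simp_all

theorem sorAt_eq_zero {r : Fin n → ℕ} (hr : Monotone r) {σ₀ : SignedPerm n}
    (hpos : ∀ k, 0 < σ₀.val k) {σ : SignedPerm n} {k : Fin n}
    (h : FixesFrom k (σ * σ₀⁻¹)) :
    BicoloredMatching.sorAt r σ.toMatching σ₀.toMatching k = 0 := by
  rw [sorAt_eq_sortWeight hr hpos (h.mono (Nat.le_succ _)), fixesFrom_mul_inv_iff.mp h k le_rfl,
    inv_pos_of_pos hpos, sortWeight, if_pos (pos_val_pos _), idx_pos,
    cyclicRank_self (symm_notMem_openPositions r σ₀ k)]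

/-- Larger letters contribute `0` on both sides, smaller ones see the same matchings, and `k`
contributes `0` once it is sorted. -/
theorem sorR_eq_add {r : Fin n → ℕ} (hr : Monotone r) {σ₀ : SignedPerm n}
    (hpos : ∀ k, 0 < σ₀.val k) {σ : SignedPerm n} {k : Fin n}
    (h : FixesFrom (k + 1) (σ * σ₀⁻¹)) :
    sorR r σ σ₀ = sortWeight r σ₀ k ((σ⁻¹).1 (pos k)) + sorR r (sortMove σ₀ k σ) σ₀ := by
  have h' := fixesFrom_sortMove h
  have hj : ∀ j, BicoloredMatching.sorAt r σ.toMatching σ₀.toMatching j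
      = (if j = k then sortWeight r σ₀ k ((σ⁻¹).1 (pos k)) else 0)
        + BicoloredMatching.sorAt r (sortMove σ₀ k σ).toMatching σ₀.toMatching j := by
    intro j
    rcases lt_trichotomy j k with hj | rfl | hj
    · rw [if_neg hj.ne, zero_add]
      unfold BicoloredMatching.sorAt
      obtain ⟨d, hd⟩ : ∃ d, ((Fin.rev j : Fin n) : ℕ) = n - k + d := by
        have h1 : (j : ℕ) < k := hj
        have := k.2
        exact ⟨k - j - 1, by rw [Fin.val_rev]; omega⟩
      rw [hd, sortStage_sortMove hpos h]
    · rw [if_pos rfl, sorAt_eq_sortWeight hr hpos h, sorAt_eq_zero hr hpos h', add_zero]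
    · rw [if_neg hj.ne', sorAt_eq_zero hr hpos (h.mono hj),
        sorAt_eq_zero hr hpos (h'.mono (le_of_lt hj))]
  unfold sorR BicoloredMatching.sor
  rw [Finset.sum_congr rfl fun j _ => hj j, Finset.sum_add_distrib, Finset.sum_ite_eq',
    if_pos (Finset.mem_univ _)]

theorem sorR_self {r : Fin n → ℕ} (hr : Monotone r) {σ₀ : SignedPerm n}
    (hpos : ∀ k, 0 < σ₀.val k) : sorR r σ₀ σ₀ = 0 := by
  unfold sorR BicoloredMatching.sor
  exact Finset.sum_eq_zero fun k _ =>
    sorAt_eq_zero hr hpos (by rw [mul_inv_cancel]; exact .one _)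

theorem sum_letter_eq_sum_pos_add_neg {R : Type*} [AddCommMonoid R] (f : Letter n → R) :
    ∑ x, f x = ∑ p : Fin n, (f (pos p) + f (-pos p)) := by
  rw [← Finset.sum_fiberwise Finset.univ idx f]
  refine Finset.sum_congr rfl fun p _ => ?_
  have : (Finset.univ.filter fun x : Letter n => x.idx = p) = {pos p, -pos p} := by
    ext x
    simp only [Finset.mem_filter, Finset.mem_univ, true_and, idx_eq_iff_pos,
      Finset.mem_insert, Finset.mem_singleton]
  rw [this, Finset.sum_pair (self_ne_neg _)]

/-- In `σ₀` the letters up to `k` occupy the position of `k`, the open positions, and every position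
with `r i ≤ k`, which can only hold a letter below `k`. -/
theorem height_eq_card {r : Fin n → ℕ} {σ₀ : SignedPerm n} (hσ₀ : σ₀ ∈ restricted r)
    (k : Fin n) :
    height r k = (openPositions r σ₀ k).card + 1 := by
  rw [mem_restricted] at hσ₀
  have h1 : (Finset.univ.filter fun i => σ₀.absPerm i ≤ k).card = k + 1 := by
    rw [← Fin.card_Iic, ← Finset.card_map σ₀.absPerm.toEmbedding]
    congr 1
    ext a
    simp only [Finset.mem_map_equiv, Finset.mem_filter, Finset.mem_univ, true_and,
      Equiv.apply_symm_apply, Finset.mem_Iic]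
  have h2 : (Finset.univ.filter fun i => σ₀.absPerm i ≤ k)
      = insert (σ₀.absPerm.symm k)
          (openPositions r σ₀ k ∪ Finset.univ.filter fun i => r i < k + 1) := by
    ext i
    simp only [openPositions, Finset.mem_filter, Finset.mem_univ, true_and, Finset.mem_insert,
      Finset.mem_union, Equiv.eq_symm_apply, Fin.le_def, Fin.lt_def, Fin.ext_iff]
    have := hσ₀ i
    omega
  rw [h2, Finset.card_insert_of_notMem, Finset.card_union_of_disjoint] at h1
  · unfold height
    omega
  · rw [Finset.disjoint_left]
    simp only [openPositions, Finset.mem_filter, Finset.mem_univ, true_and]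
    omega
  · rw [Finset.mem_union, not_or]
    refine ⟨symm_notMem_openPositions r σ₀ k, ?_⟩
    have := hσ₀ (σ₀.absPerm.symm k)
    rw [Equiv.apply_symm_apply] at this
    simp only [Finset.mem_filter, Finset.mem_univ, true_and]
    omega

theorem height_le (r : Fin n → ℕ) (k : Fin n) : height r k ≤ k + 1 := Nat.sub_le _ _

/-! ### The bijection behind one sorting step. -/

/-- The signed positions at which the letter `k` can be before it is sorted. -/
noncomputable def choices (r : Fin n → ℕ) (σ₀ : SignedPerm n) (k : Fin n) : Finset (Letter n) :=
  Finset.univ.filter fun y => (k : ℕ) < r y.idx ∧ σ₀.absPerm y.idx ≤ k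

/-- The elements of `B_r` that agree with `σ₀` at all letters with index at least `k`. -/
noncomputable def sortedFrom (r : Fin n → ℕ) (σ₀ : SignedPerm n) (k : ℕ) :
    Finset (SignedPerm n) :=
  (restricted r).filter fun σ => ∀ j : Fin n, k ≤ j → (σ⁻¹).1 (pos j) = (σ₀⁻¹).1 (pos j)

theorem mem_sortedFrom {r : Fin n → ℕ} {σ σ₀ : SignedPerm n} {k : ℕ} :
    σ ∈ sortedFrom r σ₀ k ↔ σ ∈ restricted r ∧ FixesFrom k (σ * σ₀⁻¹) := by
  rw [sortedFrom, Finset.mem_filter, fixesFrom_mul_inv_iff]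

section Bijection

variable {r : Fin n → ℕ} {σ₀ : SignedPerm n}

theorem sortMove_mem (hσ₀ : σ₀ ∈ restricted r) {k : Fin n} {σ : SignedPerm n}
    (h : σ ∈ sortedFrom r σ₀ (k + 1)) : sortMove σ₀ k σ ∈ sortedFrom r σ₀ k := by
  rw [mem_sortedFrom] at h ⊢
  refine ⟨?_, fixesFrom_sortMove h.2⟩
  rw [mem_restricted] at hσ₀ ⊢
  have hσ := mem_restricted.mp h.1
  intro i
  set y := (σ⁻¹).1 (pos k) with hy
  set z := (σ₀⁻¹).1 (pos k) with hz
  have hσy : σ.1 y = pos k := apply_inv_self _ _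
  have hσz : σ₀.1 z = pos k := apply_inv_self _ _
  have hky : (k : ℕ) < r y.idx := by
    have := hσ y.idx
    rwa [absPerm_idx, hσy, idx_pos] at this
  have hkz : (k : ℕ) < r z.idx := by
    have := hσ₀ z.idx
    rwa [absPerm_idx, hσz, idx_pos] at this
  rw [sortMove, ← hy, ← hz]
  by_cases hiz : i = z.idx
  · rw [hiz, absPerm_idx, mul_apply, signedSwap_right, hσy, idx_pos]
    exact hkz
  by_cases hiy : i = y.idx
  · rw [hiy, absPerm_idx, mul_apply, signedSwap_left]
    -- The letter moved into the position of `k` has index at most `k`, which is below `r y.idx`: a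
    -- larger one would already be at its `σ₀`-position, but `σ₀` has `k` at `z`.
    by_contra hc
    have h1 : k + 1 ≤ (σ.1 z).idx.1 := by omega
    have h2 := h.2.apply_eq (x := σ.1 z) h1
    have h3 : (σ₀⁻¹).1 (σ.1 z) = z := by
      rw [mul_apply] at h2
      exact σ.1.injective h2
    rw [inv_apply_eq, hσz] at h3
    rw [h3, idx_pos] at h1
    omega
  · rw [absPerm_apply, mul_apply, signedSwap_of_idx_ne (by rwa [idx_pos]) (by rwa [idx_pos])]
    exact hσ i

theorem inv_apply_mem_choices {k : Fin n} {σ : SignedPerm n}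
    (h : σ ∈ sortedFrom r σ₀ (k + 1)) : (σ⁻¹).1 (pos k) ∈ choices r σ₀ k := by
  rw [mem_sortedFrom] at h
  have hσ := mem_restricted.mp h.1
  unfold choices
  rw [Finset.mem_filter]
  refine ⟨Finset.mem_univ _, ?_, ?_⟩
  · have := hσ ((σ⁻¹).1 (pos k)).idx
    rwa [absPerm_idx, apply_inv_self, idx_pos] at this
  · have := h.2.delete.1
    rwa [mul_inv_rev, inv_inv, mul_apply, ← absPerm_idx] at this

theorem mul_signedSwap_mem (hσ₀ : σ₀ ∈ restricted r) {k : Fin n} {σ : SignedPerm n}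
    {y : Letter n} (h : σ ∈ sortedFrom r σ₀ k) (hy : y ∈ choices r σ₀ k) :
    σ * signedSwap y ((σ₀⁻¹).1 (pos k)) ∈ sortedFrom r σ₀ (k + 1) := by
  rw [mem_sortedFrom] at h ⊢
  unfold choices at hy
  rw [Finset.mem_filter, absPerm_idx] at hy
  obtain ⟨-, hky, hyk⟩ := hy
  have hσ := mem_restricted.mp h.1
  rw [mem_restricted] at hσ₀
  set z := (σ₀⁻¹).1 (pos k) with hz
  have hσ₀z : σ₀.1 z = pos k := apply_inv_self _ _
  have hσz : σ.1 z = pos k := h.2 k le_rfl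
  have hkz : (k : ℕ) < r z.idx := by
    have := hσ₀ z.idx
    rwa [absPerm_idx, hσ₀z, idx_pos] at this
  constructor
  · rw [mem_restricted]
    intro i
    by_cases hiy : i = y.idx
    · rw [hiy, absPerm_idx, mul_apply, signedSwap_left, hσz, idx_pos]
      exact hky
    by_cases hiz : i = z.idx
    · rw [hiz, absPerm_idx, mul_apply, signedSwap_right]
      refine lt_trans ?_ hkz
      -- If `σ y` had index at least `k`, it would equal `σ₀ y`, whose index is at most `k`; then
      -- `y` would be the position of `k`, contrary to `hiy`.
      by_contra hc
      have h2 := h.2.apply_eq (x := σ.1 y) (not_lt.mp hc)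
      have h3 : (σ₀⁻¹).1 (σ.1 y) = y := by
        rw [mul_apply] at h2
        exact σ.1.injective h2
      rw [inv_apply_eq] at h3
      rw [← h3] at hyk
      have h4 : (σ.1 y).idx = k := le_antisymm hyk (not_lt.mp hc)
      rw [← idx_pos k, ← hσz, idx_map_eq_iff] at h4
      exact hiy (hiz.trans h4.symm)
    · rw [absPerm_apply, mul_apply,
        signedSwap_of_idx_ne (by rwa [idx_pos]) (by rwa [idx_pos])]
      exact hσ i
  · have : σ * signedSwap y z * σ₀⁻¹ = σ * σ₀⁻¹ * signedSwap (σ₀.1 y) (pos k) := by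
      rw [mul_assoc, mul_assoc, ← signedSwap_conj, ← hz, inv_apply_self]
    rw [this]
    exact (h.2.mono (Nat.le_succ _)).mul (fixesFrom_signedSwap hyk)

theorem inv_apply_mul_signedSwap {k : Fin n} {σ : SignedPerm n} {y : Letter n}
    (h : σ ∈ sortedFrom r σ₀ k) :
    ((σ * signedSwap y ((σ₀⁻¹).1 (pos k)))⁻¹).1 (pos k) = y := by
  rw [sortedFrom, Finset.mem_filter] at h
  rw [mul_inv_rev, signedSwap_inv, mul_apply, h.2 k le_rfl, signedSwap_right]

end Bijection

/-! ### The product formula for the sorting index. -/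

section Distribution

variable {R : Type*}

/-- The weight of the letter `j` in `π`: `t j` for a balanced cycle minimum, `s j` for an
unbalanced cycle minimum and `u j` otherwise. -/
noncomputable def cycleWeight (t s u : Fin n → R) (π : SignedPerm n) (j : Fin n) : R :=
  if j ∈ π.cyc₀ then t j else if j ∈ π.cyc₁ then s j else u j

theorem cycleWeight_mul_signedSwap_of_lt (t s u : Fin n → R) {π : SignedPerm n} {i : Letter n}
    {k j : Fin n} (hk : π.1 (pos k) = pos k) (hj : j < k) :
    cycleWeight t s u (π * signedSwap i (pos k)) j = cycleWeight t s u π j := by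
  unfold cycleWeight
  simp only [mem_cyc₀_mul_signedSwap_of_lt hk hj, mem_cyc₁_mul_signedSwap_of_lt hk hj]

/-- The predecessor `i` decides: `k` is fixed, is mapped to `-k`, or shares its cycle with a smaller
letter. -/
theorem cycleWeight_of_apply (t s u : Fin n → R) {π : SignedPerm n} {i : Letter n} {k : Fin n}
    (h : π.1 i = pos k) (hik : i.idx ≤ k) :
    cycleWeight t s u π k = if i = pos k then t k else if i = -pos k then s k else u k := by
  unfold cycleWeight
  split_ifs with h1 h2 h3 h4 h5 h6 h7 h8
  · rfl
  · subst h3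
    rw [map_neg, neg_eq_iff_eq_neg] at h
    exact absurd (mem_cyc₁_of_apply_eq_neg h) (not_mem_cyc₁_of_mem_cyc₀ h1)
  · exact absurd h1 (not_minimal_of_idx_lt h (lt_of_le_of_ne hik fun hc =>
      (idx_eq_iff_pos.mp hc).elim h2 h3)).1
  · subst h5
    exact absurd (mem_cyc₀_of_fixed h) h1
  · rfl
  · exact absurd h4 (not_minimal_of_idx_lt h (lt_of_le_of_ne hik fun hc =>
      (idx_eq_iff_pos.mp hc).elim h5 h6)).2
  · subst h7
    exact absurd (mem_cyc₀_of_fixed h) h1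
  · subst h8
    rw [map_neg, neg_eq_iff_eq_neg] at h
    exact absurd (mem_cyc₁_of_apply_eq_neg h) h4
  · rfl

variable [CommRing R]

/-- This is the factor of `k`. The `σ₀`-position has rank `0` and gives the terms with `t` and `s`;
the open positions have ranks `1, …, h_k - 1`, each occurring with both signs. -/
theorem sum_choices {r : Fin n → ℕ} {σ₀ : SignedPerm n} (hσ₀ : σ₀ ∈ restricted r)
    (hpos : ∀ k, 0 < σ₀.val k) (k : Fin n) (q t s u : R) :
    ∑ y ∈ choices r σ₀ k, q ^ sortWeight r σ₀ k y *
        (if σ₀.1 y = pos k then t else if σ₀.1 y = -pos k then s else u)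
      = t + u * ((q + q ^ (2 * (k + 1 : ℕ) - height r k)) * qInt q (height r k - 1))
        + s * q ^ (2 * (k + 1 : ℕ) - 1) := by
  have hz := inv_pos_of_pos hpos k
  set p₀ := σ₀.absPerm.symm k with hp₀
  have hσp : σ₀.1 (pos p₀) = pos k := by rw [← hz, apply_inv_self]
  have hkp : (k : ℕ) < r p₀ := by
    have := mem_restricted.mp hσ₀ p₀
    rwa [hp₀, Equiv.apply_symm_apply] at this
  have hS := symm_notMem_openPositions r σ₀ k
  have hset : (Finset.univ.filter fun p => (k : ℕ) < r p ∧ σ₀.absPerm p ≤ k)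
      = insert p₀ (openPositions r σ₀ k) := by
    ext p
    simp only [openPositions, Finset.mem_filter, Finset.mem_univ, true_and, Finset.mem_insert,
      hp₀, Equiv.eq_symm_apply, Fin.le_def, Fin.lt_def, Fin.ext_iff]
    constructor
    · omega
    · rintro (h | h)
      · rw [← Fin.ext_iff, ← Equiv.eq_symm_apply, ← hp₀] at h
        subst h
        exact ⟨hkp, by rw [hp₀, Equiv.apply_symm_apply]⟩
      · omega
  have hother : ∀ p ∈ openPositions r σ₀ k, ∀ y : Letter n, y.idx = p →
      σ₀.1 y ≠ pos k ∧ σ₀.1 y ≠ -pos k := by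
    intro p hp y hy
    rw [← not_or, ← idx_eq_iff_pos, ← absPerm_idx, hy, ← Equiv.eq_symm_apply]
    exact fun h => hS (h ▸ hp)
  rw [choices, Finset.sum_filter, sum_letter_eq_sum_pos_add_neg]
  simp only [idx_pos, idx_neg]
  have hite : ∀ p : Fin n, ∀ a b : R, ((if (k : ℕ) < r p ∧ σ₀.absPerm p ≤ k then a else 0)
      + (if (k : ℕ) < r p ∧ σ₀.absPerm p ≤ k then b else 0))
      = if (k : ℕ) < r p ∧ σ₀.absPerm p ≤ k then a + b else 0 := by
    intro p a b
    split_ifs <;> simp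
  simp only [hite]
  rw [← Finset.sum_filter, hset, Finset.sum_insert hS]
  have hweight : ∀ p, sortWeight r σ₀ k (pos p) = cyclicRank (openPositions r σ₀ k) p₀ p ∧
      sortWeight r σ₀ k (-pos p) = 2 * k + 1 - cyclicRank (openPositions r σ₀ k) p₀ p := by
    intro p
    unfold sortWeight
    rw [if_pos (pos_val_pos p), if_neg (not_neg_pos_val_pos p), idx_neg, idx_pos]
    exact ⟨rfl, rfl⟩
  have hsum : ∀ p ∈ openPositions r σ₀ k,
      (q ^ sortWeight r σ₀ k (pos p) *
          (if σ₀.1 (pos p) = pos k then t else if σ₀.1 (pos p) = -pos k then s else u)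
        + q ^ sortWeight r σ₀ k (-pos p) *
          (if σ₀.1 (-pos p) = pos k then t else if σ₀.1 (-pos p) = -pos k then s else u))
      = (fun m => q ^ m * u + q ^ (2 * (k : ℕ) + 1 - m) * u)
          (cyclicRank (openPositions r σ₀ k) p₀ p) := by
    intro p hp
    have h1 := hother p hp (pos p) (idx_pos p)
    have h2 := hother p hp (-pos p) (by rw [idx_neg, idx_pos])
    rw [(hweight p).1, (hweight p).2, if_neg h1.1, if_neg h1.2, if_neg h2.1, if_neg h2.2]
  rw [Finset.sum_congr rfl hsum, sum_cyclicRank hS (fun m => q ^ m * u + q ^ (2 * (k : ℕ) + 1 - m) * u),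
    (hweight p₀).1, (hweight p₀).2, cyclicRank_self hS, map_neg, hσp,
    if_pos rfl, if_neg (neg_ne _), if_pos rfl]
  have hh := height_eq_card hσ₀ k
  have hle := height_le r k
  set m := (openPositions r σ₀ k).card
  have e1 : ∑ i ∈ Finset.range m, q ^ (i + 1) = q * qInt q m := by
    rw [qInt, Finset.mul_sum]
    exact Finset.sum_congr rfl fun i _ => pow_succ' q i
  -- Read backwards, the exponents increase from `2 * k + 1 - m`, which is `2 * (k + 1) - h_k`
  -- because `h_k = m + 1`.
  have e2 : ∑ i ∈ Finset.range m, q ^ (2 * (k : ℕ) + 1 - (i + 1))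
      = q ^ (2 * (k + 1 : ℕ) - height r k) * qInt q m := by
    rw [qInt, Finset.mul_sum, ← Finset.sum_range_reflect]
    refine Finset.sum_congr rfl fun i hi => ?_
    rw [Finset.mem_range] at hi
    rw [← pow_add]
    congr 1
    omega
  rw [Finset.sum_add_distrib, ← Finset.sum_mul, ← Finset.sum_mul, e1, e2, hh,
    Nat.add_sub_cancel, ← hh]
  have e3 : 2 * (k : ℕ) + 1 - 0 = 2 * (k + 1 : ℕ) - 1 := by omega
  rw [e3]
  ring

/-- Recording the sorted permutation and the previous signed position of `k` identifies `sortedFrom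
r σ₀ (k + 1)` with `sortedFrom r σ₀ k ×ˢ choices r σ₀ k`, and the weight is multiplicative along
this bijection. -/
theorem sum_sortedFrom {r : Fin n → ℕ} (hr : Monotone r) {σ₀ : SignedPerm n}
    (hσ₀ : σ₀ ∈ restricted r) (hpos : ∀ k, 0 < σ₀.val k) (q : R) (t s u : Fin n → R) :
    ∀ k : ℕ, k ≤ n →
      ∑ σ ∈ sortedFrom r σ₀ k, q ^ sorR r σ σ₀ *
          ∏ j ∈ Finset.univ.filter (fun j : Fin n => (j : ℕ) < k), cycleWeight t s u (σ * σ₀⁻¹) j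
        = ∏ j ∈ Finset.univ.filter (fun j : Fin n => (j : ℕ) < k), (t j
            + u j * ((q + q ^ (2 * (j + 1 : ℕ) - height r j)) * qInt q (height r j - 1))
            + s j * q ^ (2 * (j + 1 : ℕ) - 1)) := by
  intro k
  induction k with
  | zero =>
    intro _
    have h : sortedFrom r σ₀ 0 = {σ₀} := by
      ext σ
      rw [mem_sortedFrom, Finset.mem_singleton]
      constructor
      · rintro ⟨-, h⟩
        exact mul_inv_eq_one.mp h.eq_one
      · rintro rfl
        exact ⟨hσ₀, by rw [mul_inv_cancel]; exact .one _⟩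
    simp [h, sorR_self hr hpos]
  | succ k ih =>
    intro hkn
    obtain ⟨k, rfl⟩ : ∃ k' : Fin n, (k' : ℕ) = k := ⟨⟨k, hkn⟩, rfl⟩
    have hins : (Finset.univ.filter fun j : Fin n => (j : ℕ) < k + 1)
        = insert k (Finset.univ.filter fun j : Fin n => (j : ℕ) < k) := by
      ext j
      simp only [Finset.mem_filter, Finset.mem_univ, true_and, Finset.mem_insert, Fin.ext_iff]
      omega
    have hnot : k ∉ Finset.univ.filter fun j : Fin n => (j : ℕ) < k := by simp
    rw [hins, Finset.prod_insert hnot, ← ih (by omega),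
      ← sum_choices hσ₀ hpos k q (t k) (s k) (u k), mul_comm, Finset.sum_mul_sum,
      ← Finset.sum_product']
    refine Finset.sum_nbij' (fun σ => (sortMove σ₀ k σ, (σ⁻¹).1 (pos k)))
      (fun p => p.1 * signedSwap p.2 ((σ₀⁻¹).1 (pos k))) ?_ ?_ ?_ ?_ ?_
    · intro σ hσ
      exact Finset.mem_product.mpr ⟨sortMove_mem hσ₀ hσ, inv_apply_mem_choices hσ⟩
    · intro p hp
      rw [Finset.mem_product] at hp
      exact mul_signedSwap_mem hσ₀ hp.1 hp.2
    · intro σ _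
      exact mul_signedSwap_cancel _ _ _
    · intro p hp
      rw [Finset.mem_product] at hp
      have h := inv_apply_mul_signedSwap (y := p.2) hp.1
      refine Prod.ext ?_ h
      change sortMove _ _ _ = _
      rw [sortMove, h, mul_signedSwap_cancel]
    · intro σ hσ
      have hfix := (mem_sortedFrom.mp hσ).2
      have hdel := hfix.delete
      have hπ : (((σ * σ₀⁻¹)⁻¹).1 (pos k)) = σ₀.1 ((σ⁻¹).1 (pos k)) := by
        rw [mul_inv_rev, inv_inv, mul_apply]
      have hw : ∀ j ∈ Finset.univ.filter (fun j : Fin n => (j : ℕ) < k),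
          cycleWeight t s u (σ * σ₀⁻¹) j = cycleWeight t s u (sortMove σ₀ k σ * σ₀⁻¹) j := by
        intro j hj
        rw [Finset.mem_filter] at hj
        rw [sortMove_mul_inv, ← cycleWeight_mul_signedSwap_of_lt t s u (hdel.2 k le_rfl) hj.2,
          mul_signedSwap_cancel]
      rw [Finset.prod_insert hnot, Finset.prod_congr rfl hw, sorR_eq_add hr hpos hfix,
        cycleWeight_of_apply t s u (apply_inv_self _ _) hdel.1, hπ, pow_add]
      ring

theorem sum_sorR_cycleWeight {r : Fin n → ℕ} (hr : Monotone r) {σ₀ : SignedPerm n}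
    (hσ₀ : σ₀ ∈ restricted r) (hpos : ∀ k, 0 < σ₀.val k) (q : R) (t s u : Fin n → R) :
    ∑ σ ∈ restricted r, q ^ sorR r σ σ₀ * ∏ j, cycleWeight t s u (σ * σ₀⁻¹) j
      = ∏ j : Fin n, (t j
          + u j * ((q + q ^ (2 * (j + 1 : ℕ) - height r j)) * qInt q (height r j - 1))
          + s j * q ^ (2 * (j + 1 : ℕ) - 1)) := by
  have h := sum_sortedFrom hr hσ₀ hpos q t s u n le_rfl
  have h1 : sortedFrom r σ₀ n = restricted r := by
    ext σ
    rw [mem_sortedFrom]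
    exact and_iff_left (fixesFrom_of_le le_rfl _)
  simpa only [h1, Fin.is_lt, Finset.filter_true] using h

end Distribution

/-! ### Lehmer codes and type `B` inversions. -/

/-- The number of letters `a < b` that stand to the right of `b`, where `P b` is the position
of `b`. -/
def lehmer (P : Equiv.Perm (Fin n)) (b : Fin n) : ℕ :=
  (Finset.univ.filter fun a => a < b ∧ P b < P a).card

/-- Letters are inserted in increasing order: the letters to the right of the new one form a final
segment of the order known so far, determined by its size. -/
theorem lehmer_injective : Function.Injective (lehmer : Equiv.Perm (Fin n) → Fin n → ℕ) := by
  intro P Q h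
  have key : ∀ m : ℕ, ∀ a b : Fin n, (a : ℕ) < m → (b : ℕ) < m → (P a < P b → Q a < Q b) ∧
      (Q a < Q b → P a < P b) := by
    intro m
    induction m with
    | zero => intro a b ha; omega
    | succ m ih =>
      by_cases hmn : m < n
      swap
      · exact fun a b _ _ => ih a b (by omega) (by omega)
      let c : Fin n := ⟨m, hmn⟩
      have hcard := congrFun h c
      have hset : (Finset.univ.filter fun a => a < c ∧ P c < P a)
          = Finset.univ.filter fun a => a < c ∧ Q c < Q a := by
        -- Final segments of one linear order are comparable, so equal cardinality gives equality.
        by_cases hsub : (Finset.univ.filter fun a => a < c ∧ P c < P a)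
            ⊆ Finset.univ.filter fun a => a < c ∧ Q c < Q a
        · exact Finset.eq_of_subset_of_card_le hsub hcard.ge
        by_cases hsub' : (Finset.univ.filter fun a => a < c ∧ Q c < Q a)
            ⊆ Finset.univ.filter fun a => a < c ∧ P c < P a
        · exact (Finset.eq_of_subset_of_card_le hsub' hcard.le).symm
        · exfalso
          rw [Finset.not_subset] at hsub hsub'
          obtain ⟨a, ha, ha'⟩ := hsub
          obtain ⟨b, hb, hb'⟩ := hsub'
          simp only [Finset.mem_filter, Finset.mem_univ, true_and, not_and, not_lt]
            at ha ha' hb hb'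
          have h1 : P b < P a := (hb' hb.1).trans_lt ha.2
          have h2 : Q a < Q b := (ha' ha.1).trans_lt hb.2
          exact lt_asymm h2 ((ih b a hb.1 ha.1).1 h1)
      have hc : ∀ a : Fin n, (a : ℕ) < m → (P c < P a ↔ Q c < Q a) := by
        intro a ha
        have h1 := congrArg (a ∈ ·) hset
        have h2 : a < c := ha
        simpa only [Finset.mem_filter, Finset.mem_univ, true_and, h2, eq_iff_iff] using h1
      have hc' : ∀ a : Fin n, (a : ℕ) < m → (P a < P c ↔ Q a < Q c) := by
        intro a ha
        have h1 : a ≠ c := fun h' => by rw [h'] at ha; exact lt_irrefl _ ha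
        have h2 : P a ≠ P c := P.injective.ne h1
        have h3 : Q a ≠ Q c := Q.injective.ne h1
        rw [← not_iff_not, not_lt, not_lt, le_iff_lt_or_eq, le_iff_lt_or_eq, hc a ha]
        simp only [h2.symm, h3.symm, or_false]
      intro a b ha hb
      rcases Nat.lt_succ_iff_lt_or_eq.mp ha with ha | ha <;>
        rcases Nat.lt_succ_iff_lt_or_eq.mp hb with hb | hb
      · exact ih a b ha hb
      · obtain rfl : b = c := Fin.ext hb
        exact ⟨(hc' a ha).1, (hc' a ha).2⟩
      · obtain rfl : a = c := Fin.ext ha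
        exact ⟨(hc b hb).1, (hc b hb).2⟩
      · obtain rfl : a = c := Fin.ext ha
        obtain rfl : b = c := Fin.ext hb
        exact ⟨fun h' => absurd h' (lt_irrefl _), fun h' => absurd h' (lt_irrefl _)⟩
  -- Since `P` and `Q` order the letters alike, `P⁻¹` followed by `Q` is an order automorphism of
  -- `Fin n`, hence the identity.
  let e : Fin n ≃o Fin n :=
    { toEquiv := P.symm.trans Q
      map_rel_iff' := by
        intro a b
        change Q (P.symm a) ≤ Q (P.symm b) ↔ a ≤ b
        have h1 := key n (P.symm b) (P.symm a) (Fin.is_lt _) (Fin.is_lt _)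
        rw [P.apply_symm_apply, P.apply_symm_apply] at h1
        rw [← not_iff_not, not_le, not_le]
        exact ⟨h1.2, h1.1⟩ }
  have he : e = OrderIso.refl _ := Subsingleton.elim _ _
  ext1 a
  have h1 : Q (P.symm (P a)) = P a := congrArg (fun f : Fin n ≃o Fin n => f (P a)) he
  rw [P.symm_apply_apply] at h1
  exact h1.symm

/-- Positions with `r i ≤ b` lie to the left of `b`, since `r` is monotone, and hold letters below
`b`. These letters are disjoint from the ones counted by `lehmer`. -/
theorem lehmer_lt_height {r : Fin n → ℕ} (hr : Monotone r) {σ : SignedPerm n}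
    (hσ : σ ∈ restricted r) (b : Fin n) : lehmer σ.absPerm.symm b < height r b := by
  rw [mem_restricted] at hσ
  have h1 : (Finset.univ.filter fun a => a < b ∧ σ.absPerm.symm b < σ.absPerm.symm a).card
      + (Finset.univ.filter fun i => r i < b + 1).card ≤ (Finset.Iio b).card := by
    rw [← Finset.card_map (s := Finset.univ.filter fun i => r i < b + 1) σ.absPerm.toEmbedding,
      ← Finset.card_union_of_disjoint]
    · refine Finset.card_le_card fun a ha => ?_
      simp only [Finset.mem_union, Finset.mem_map_equiv, Finset.mem_filter, Finset.mem_univ,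
        true_and] at ha
      rw [Finset.mem_Iio]
      rcases ha with ha | ha
      · exact ha.1
      · have := hσ (σ.absPerm.symm a)
        rw [Equiv.apply_symm_apply] at this
        exact Fin.lt_def.mpr (by omega)
    · rw [Finset.disjoint_left]
      intro a ha ha'
      simp only [Finset.mem_map_equiv, Finset.mem_filter, Finset.mem_univ, true_and] at ha ha'
      have h2 := hσ (σ.absPerm.symm b)
      rw [Equiv.apply_symm_apply] at h2
      have h3 := hr ha.2.le
      omega
  rw [Fin.card_Iio] at h1
  unfold lehmer height
  omega

/-- The contribution of the letter `b` to the number of inversions. -/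
def invWeight (b : Fin n) (c : Bool × ℕ) : ℕ := if c.1 then c.2 else 2 * b + 1 - c.2

/-- The signs and the Lehmer code of a signed permutation. -/
noncomputable def code (σ : SignedPerm n) (b : Fin n) : Bool × ℕ :=
  (decide (0 < ((σ⁻¹).1 (pos b)).1), lehmer σ.absPerm.symm b)

theorem code_injective : Function.Injective (code : SignedPerm n → Fin n → Bool × ℕ) := by
  intro σ τ h
  have h1 : σ.absPerm.symm = τ.absPerm.symm :=
    lehmer_injective (funext fun b => congrArg Prod.snd (congrFun h b))
  rw [← inv_inj]
  refine ext_pos fun b => ?_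
  have h2 := congrArg Prod.fst (congrFun h b)
  have h3 : ((σ⁻¹).1 (pos b)).idx = ((τ⁻¹).1 (pos b)).idx := by
    rw [← absPerm_symm_apply, h1, absPerm_symm_apply]
  have h2 : (0 < ((σ⁻¹).1 (pos b)).1) ↔ 0 < ((τ⁻¹).1 (pos b)).1 := decide_eq_decide.mp h2
  by_cases h4 : 0 < ((σ⁻¹).1 (pos b)).1
  · rw [eq_pos_idx h4, eq_pos_idx (h2.mp h4), h3]
  · rw [eq_neg_pos_idx h4, eq_neg_pos_idx (mt h2.mpr h4), h3]

theorem mem_prlminl_iff {σ : SignedPerm n} {b : Fin n} :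
    b ∈ σ.prlminl ↔ σ.code b = (true, 0) := by
  rw [mem_prlminl, code, Prod.mk.injEq, decide_eq_true_iff, lehmer, Finset.card_eq_zero,
    Finset.filter_eq_empty_iff]
  constructor
  · rintro ⟨k, hk, hmin⟩
    have h1 : (σ⁻¹).1 (pos b) = pos k := by rw [inv_apply_eq, hk]
    refine ⟨by rw [h1]; exact pos_val_pos k, fun a _ ha => ?_⟩
    have h2 := hmin (σ.absPerm.symm a) (by rw [← idx_pos k, ← h1]; exact ha.2)
    rw [Equiv.apply_symm_apply, absPerm_apply, hk, idx_pos] at h2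
    exact lt_asymm h2 ha.1
  · rintro ⟨hb, hmin⟩
    have hk : σ.1 (pos (σ.absPerm.symm b)) = pos b := by
      rw [absPerm_symm_apply, ← eq_pos_idx hb, apply_inv_self]
    refine ⟨σ.absPerm.symm b, hk, fun l hl => ?_⟩
    rw [Equiv.apply_symm_apply]
    by_contra hc
    refine hmin (Finset.mem_univ (σ.absPerm l)) ⟨lt_of_le_of_ne (not_lt.mp hc) fun h => ?_, ?_⟩
    · rw [← h, Equiv.symm_apply_apply] at hl
      exact lt_irrefl _ hl
    · rwa [Equiv.symm_apply_apply]

/-- If `m` of the `b` smaller letters stand to the right of a negative letter of index `b`, then `b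
- m` stand to its left, and `2b + 1 - m = m + 1 + 2(b - m)`. -/
theorem invWeight_code_absPerm (σ : SignedPerm n) (p : Fin n) :
    invWeight (σ.absPerm p) (σ.code (σ.absPerm p))
      = (∑ j, if p < j ∧ σ.absPerm j < σ.absPerm p then 1 else 0)
        + ((if σ.val p < 0 then 1 else 0)
          + ∑ i, if i < p ∧ σ.absPerm i < σ.absPerm p ∧ σ.val p < 0 then 2 else 0) := by
  have h0 := σ.val_ne_zero p
  have hl : lehmer σ.absPerm.symm (σ.absPerm p)
      = (Finset.univ.filter fun j => p < j ∧ σ.absPerm j < σ.absPerm p).card := by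
    unfold lehmer
    rw [← Finset.card_map σ.absPerm.symm.toEmbedding]
    congr 1
    ext j
    simp only [Finset.mem_map_equiv, Finset.mem_filter, Finset.mem_univ, true_and,
      Equiv.symm_symm, Equiv.symm_apply_apply, and_comm]
  have hsign : decide (0 < ((σ⁻¹).1 (pos (σ.absPerm p))).1) = decide (0 < σ.val p) := by
    rw [decide_eq_decide, absPerm_apply]
    by_cases h : 0 < σ.val p
    · have h1 := eq_pos_idx h
      rw [← h1, inv_apply_self]
      exact iff_of_true (pos_val_pos p) h
    · have h1 := neg_eq_iff_eq_neg.mpr (eq_neg_pos_idx h)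
      rw [← h1, map_neg, inv_apply_self]
      exact iff_of_false (not_neg_pos_val_pos p) h
  unfold code invWeight
  rw [hsign, hl, ← Finset.card_filter]
  by_cases h : 0 < σ.val p
  · have h' : ¬ σ.val p < 0 := by omega
    simp [h, h']
  · have h' : σ.val p < 0 := by omega
    have hcard : (Finset.univ.filter fun j => p < j ∧ σ.absPerm j < σ.absPerm p).card
        + (Finset.univ.filter fun j => j < p ∧ σ.absPerm j < σ.absPerm p).card
        = σ.absPerm p := by
      rw [← Fin.card_Iio (σ.absPerm p), ← Finset.card_map σ.absPerm.symm.toEmbedding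
        (s := Finset.Iio _), ← Finset.card_union_of_disjoint]
      · congr 1
        ext j
        simp only [Finset.mem_map_equiv, Finset.mem_union, Finset.mem_filter, Finset.mem_univ,
          true_and, Equiv.symm_symm, Finset.mem_Iio, ← or_and_right]
        refine and_iff_right_of_imp fun hj => ?_
        rw [← ne_iff_lt_or_gt]
        rintro rfl
        exact lt_irrefl _ hj
      · rw [Finset.disjoint_left]
        simp only [Finset.mem_filter, Finset.mem_univ, true_and]
        exact fun j hj hj' => lt_asymm hj.1 hj'.1
    simp only [h, h', and_true, decide_false, if_true, Bool.false_eq_true, if_false]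
    rw [← Finset.sum_filter, Finset.sum_const, smul_eq_mul]
    omega

/-- For `i < j`, the two inversion conditions together count `1` if `|σ(j)| < |σ(i)|`. Otherwise
they count `2` or `0`, according to whether `σ(j)` is negative. -/
theorem invB_eq_sum (σ : SignedPerm n) : σ.invB = ∑ b, invWeight b (σ.code b) := by
  have hpair : ∀ i j : Fin n,
      (if i < j ∧ σ.val j < σ.val i then 1 else 0) + (if i < j ∧ σ.val j < -σ.val i then 1 else 0)
      = (if i < j ∧ σ.absPerm j < σ.absPerm i then 1 else 0)
        + (if i < j ∧ σ.absPerm i < σ.absPerm j ∧ σ.val j < 0 then 2 else 0) := by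
    intro i j
    by_cases hij : i < j
    · have h1 := abs_cases (σ.val i)
      have h2 := abs_cases (σ.val j)
      have h3 : (σ.absPerm i : ℕ) ≠ σ.absPerm j := fun h =>
        hij.ne (σ.absPerm.injective (Fin.ext h))
      have h4 := σ.val_ne_zero j
      rw [abs_val] at h1 h2
      simp only [hij, true_and, Fin.lt_def]
      split_ifs <;> omega
    · simp only [hij, false_and, if_false]
  have hsum : (∑ i, ∑ j, if i < j ∧ σ.val j < σ.val i then 1 else 0)
      + (∑ i, ∑ j, if i < j ∧ σ.val j < -σ.val i then 1 else 0)
      = (∑ i, ∑ j, if i < j ∧ σ.absPerm j < σ.absPerm i then 1 else 0)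
        + ∑ i, ∑ j, if i < j ∧ σ.absPerm i < σ.absPerm j ∧ σ.val j < 0 then 2 else 0 := by
    simp only [← Finset.sum_add_distrib, hpair]
  have hcomm : (∑ i, ∑ j, if i < j ∧ σ.absPerm i < σ.absPerm j ∧ σ.val j < 0 then 2 else 0)
      = ∑ j, ∑ i, if i < j ∧ σ.absPerm i < σ.absPerm j ∧ σ.val j < 0 then 2 else 0 :=
    Finset.sum_comm
  rw [← Equiv.sum_comp σ.absPerm]
  simp only [invWeight_code_absPerm]
  rw [Finset.sum_add_distrib, Finset.sum_add_distrib, invB, numNeg, Finset.card_filter,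
    Finset.card_filter, Finset.card_filter, Fintype.sum_prod_type, Fintype.sum_prod_type, hsum,
    hcomm]
  ring

section Inversions

variable {R : Type*} [CommRing R]

theorem one_val_pos (k : Fin n) : 0 < (1 : SignedPerm n).val k := pos_val_pos k

/-- The codes lie in the box by `lehmer_lt_height`. The sorting formula with all parameters equal to
`1` gives `∏ 2 * h_k` elements of `B_r`, which is the size of the box. -/
theorem image_code_restricted {r : Fin n → ℕ} (hr : Monotone r) {σ₀ : SignedPerm n}
    (hσ₀ : σ₀ ∈ restricted r) (hpos : ∀ k, 0 < σ₀.val k) :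
    (restricted r).image code
      = Fintype.piFinset fun b : Fin n => Finset.univ ×ˢ Finset.range (height r b) := by
  refine Finset.eq_of_subset_of_card_le ?_ ?_
  · intro c hc
    obtain ⟨σ, hσ, rfl⟩ := Finset.mem_image.mp hc
    rw [Fintype.mem_piFinset]
    exact fun b => Finset.mem_product.mpr
      ⟨Finset.mem_univ _, Finset.mem_range.mpr (lehmer_lt_height hr hσ b)⟩
  · rw [Finset.card_image_of_injective _ code_injective, Fintype.card_piFinset]
    have h := sum_sorR_cycleWeight (R := ℤ) hr hσ₀ hpos 1 1 1 1
    have h1 : ∀ (π : SignedPerm n) (j : Fin n),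
        cycleWeight (1 : Fin n → ℤ) 1 1 π j = 1 := fun π j => by
      simp [cycleWeight]
    simp only [h1, one_pow, Finset.prod_const_one, mul_one, Finset.sum_const, nsmul_eq_mul,
      qInt, Finset.card_range, Pi.one_apply, one_mul] at h
    refine le_of_eq (Int.natCast_inj.mp ?_)
    rw [h, Nat.cast_prod]
    refine Finset.prod_congr rfl fun b _ => ?_
    rw [Finset.card_product, Finset.card_univ, Fintype.card_bool, Finset.card_range,
      height_eq_card hσ₀, Nat.add_sub_cancel]
    push_cast
    ring

theorem sum_codes {r : Fin n → ℕ} {b : Fin n} (hb : 0 < height r b) (q t u : R) :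
    ∑ c ∈ (Finset.univ : Finset Bool) ×ˢ Finset.range (height r b),
        q ^ invWeight b c * (if c = (true, 0) then t else u)
      = t + u * (q * qInt q (height r b - 1)
          + q ^ (2 * (b + 1 : ℕ) - height r b) * qInt q (height r b)) := by
  have hle := height_le r b
  have e1 : ∑ m ∈ Finset.range (height r b),
      q ^ invWeight b (true, m) * (if ((true, m) : Bool × ℕ) = (true, 0) then t else u)
      = t + u * (q * qInt q (height r b - 1)) := by
    obtain ⟨m, hm⟩ : ∃ m, height r b = m + 1 := ⟨height r b - 1, by omega⟩
    rw [hm, Finset.sum_range_succ', Nat.add_sub_cancel, qInt, Finset.mul_sum, Finset.mul_sum,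
      add_comm]
    congr 1
    · simp [invWeight]
    · refine Finset.sum_congr rfl fun i _ => ?_
      simp only [invWeight, if_true, Prod.mk.injEq, true_and, Nat.add_one_ne_zero, if_false]
      ring
  have e2 : ∑ m ∈ Finset.range (height r b),
      q ^ invWeight b (false, m) * (if ((false, m) : Bool × ℕ) = (true, 0) then t else u)
      = u * (q ^ (2 * (b + 1 : ℕ) - height r b) * qInt q (height r b)) := by
    rw [qInt, Finset.mul_sum, ← Finset.sum_range_reflect, Finset.mul_sum]
    refine Finset.sum_congr rfl fun i hi => ?_
    rw [Finset.mem_range] at hi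
    simp only [invWeight, Bool.false_eq_true, if_false, Prod.mk.injEq, false_and]
    rw [← pow_add, mul_comm]
    congr 2
    omega
  rw [Finset.sum_product, Fintype.sum_bool, e1, e2]
  ring

theorem sum_invB_prlminl {r : Fin n → ℕ} (hr : Monotone r) {σ₀ : SignedPerm n}
    (hσ₀ : σ₀ ∈ restricted r) (hpos : ∀ k, 0 < σ₀.val k) (q : R) (t u : Fin n → R) :
    ∑ σ ∈ restricted r, q ^ σ.invB * ∏ b, (if b ∈ σ.prlminl then t b else u b)
      = ∏ b : Fin n, (t b + u b * (q * qInt q (height r b - 1)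
          + q ^ (2 * (b + 1 : ℕ) - height r b) * qInt q (height r b))) := by
  have h1 : ∀ σ : SignedPerm n,
      q ^ σ.invB * ∏ b, (if b ∈ σ.prlminl then t b else u b)
      = (fun c : Fin n → Bool × ℕ =>
          ∏ b, q ^ invWeight b (c b) * (if c b = (true, 0) then t b else u b)) σ.code := by
    intro σ
    simp only [mem_prlminl_iff]
    rw [invB_eq_sum, Finset.prod_mul_distrib, Finset.prod_pow_eq_pow_sum]
  rw [Finset.sum_congr rfl fun σ _ => h1 σ, ← Finset.sum_image
      (f := fun c : Fin n → Bool × ℕ =>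
        ∏ b, q ^ invWeight b (c b) * (if c b = (true, 0) then t b else u b))
      code_injective.injOn,
    image_code_restricted hr hσ₀ hpos,
    ← Finset.prod_univ_sum (fun b : Fin n => Finset.univ ×ˢ Finset.range (height r b))
      (fun b c => q ^ invWeight b c * (if c = (true, 0) then t b else u b))]
  refine Finset.prod_congr rfl fun b _ => sum_codes ?_ _ _ _
  rw [height_eq_card hσ₀]
  omega

end Inversions

/-! ### The sorting index `sor_B` as sorting towards the identity. -/

section SortingFactorization

variable {r : Fin n → ℕ}

/-- For `σ₀ = 1`, monotonicity and `k < r i.idx` make every position from `i.idx` up to `k - 1`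
open, so the rank is `k - i.idx`. -/
theorem sortWeight_one (hr : Monotone r) {k : Fin n} {i : Letter n} (hi : i.idx ≤ k)
    (hk : (k : ℕ) < r i.idx) :
    (sortWeight r 1 k i : ℤ) = (pos k).1 - i.1 - if i.1 < 0 then 1 else 0 := by
  have h1 : (1 : SignedPerm n).absPerm.symm k = k := idx_pos k
  have h2 : ∀ p, (1 : SignedPerm n).absPerm p = p := idx_pos
  have hrank : cyclicRank (openPositions r 1 k) k i.idx = k - i.idx := by
    rw [cyclicRank, if_pos hi, ← Fin.card_Ico]
    congr 1
    ext p
    simp only [openPositions, h2, Finset.mem_filter, Finset.mem_univ, true_and, Finset.mem_Ico]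
    constructor
    · exact fun h => ⟨h.2.1, h.1.2⟩
    · exact fun h => ⟨⟨hk.trans_le (hr h.1), h.2⟩, h.1, h.2.le⟩
  have h3 := i.natAbs_eq
  have h4 := i.val_ne_zero
  have hi : (i.idx : ℕ) ≤ k := hi
  rw [sortWeight, h1, hrank, val_pos]
  split_ifs <;> omega

/-- The earlier factors fix all letters from `k` on, so the last factor must be the transposition
used in the sorting step at `k`. Hence every sorting factorization has the same weight, and the
infimum defining `sorB` is over a single value. -/
theorem sortingFactorization_weight (hr : Monotone r) (h1 : (1 : SignedPerm n) ∈ restricted r)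
    (L : List (Letter n × Letter n × SignedPerm n)) : ∀ σ : SignedPerm n, σ ∈ restricted r →
      IsSortingFactorization σ L →
      (L.map fun p => p.2.1.1 - p.1.1 - if p.1.1 < 0 then 1 else 0).sum = (sorR r σ 1 : ℤ) := by
  induction L using List.reverseRecOn with
  | nil =>
    rintro σ - ⟨-, -, hprod⟩
    rw [List.map_nil, List.prod_nil] at hprod
    rw [← hprod, sorR_self hr one_val_pos]
    rfl
  | append_singleton L p ih =>
    rintro σ hσ ⟨hT, hP, hprod⟩
    obtain ⟨i, j, τ⟩ := p
    rw [List.pairwise_append] at hP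
    obtain ⟨hP, -, hlt⟩ := hP
    have hTp := hT (i, j, τ) (by simp)
    have hTL : ∀ p ∈ L, IsTransposition p.1 p.2.1 p.2.2 :=
      fun p hp => hT p (List.mem_append_left _ hp)
    rw [List.map_append, List.prod_append, List.map_singleton, List.prod_singleton] at hprod
    obtain ⟨k, rfl⟩ : ∃ k, j = pos k := ⟨_, eq_pos_idx hTp.1⟩
    have hik : i.idx ≤ k := by
      have := hTp.idx_le
      rwa [idx_pos] at this
    change _ * τ = σ at hprod
    have hτ : τ = signedSwap i (pos k) := hTp.eq_signedSwap
    set ρ := (L.map fun p => p.2.2).prod with hρ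
    have hfix : FixesFrom k ρ := by
      intro a ha
      have hmem : ∀ p ∈ L, p.2.2.1 (pos a) = pos a := by
        intro p hp
        have hp' := hTL p hp
        have hlt' := hlt p hp (i, pos k, τ) (by simp)
        change p.2.1.1 < (pos k).1 at hlt'
        have hj := eq_pos_idx hp'.1
        rw [hj, val_pos, val_pos] at hlt'
        have hle := hp'.idx_le
        rw [hp'.eq_signedSwap, hj]
        refine fixesFrom_signedSwap hle a ?_
        omega
      rw [hρ]
      clear * - hmem
      induction L with
      | nil => rfl
      | cons p L ih =>
        rw [List.map_cons, List.prod_cons, mul_apply,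
          ih fun p' h' => hmem p' (List.mem_cons_of_mem _ h'), hmem p List.mem_cons_self]
    have hσfix : FixesFrom (k + 1) (σ * 1⁻¹) := by
      rw [inv_one, mul_one, ← hprod, hτ]
      exact (hfix.mono (Nat.le_succ _)).mul (fixesFrom_signedSwap hik)
    have hinv : (σ⁻¹).1 (pos k) = i := by
      rw [inv_apply_eq, ← hprod, hτ, mul_apply, signedSwap_left, hfix k le_rfl]
    have hmove : sortMove 1 k σ = ρ := by
      rw [sortMove, hinv, inv_one]
      change σ * signedSwap i (pos k) = ρ
      rw [← hprod, hτ, mul_signedSwap_cancel]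
    have hmem : ρ ∈ restricted r := by
      rw [← hmove]
      exact (mem_sortedFrom.mp (sortMove_mem h1 (mem_sortedFrom.mpr ⟨hσ, hσfix⟩))).1
    have hki : (k : ℕ) < r i.idx := by
      have := mem_restricted.mp hσ i.idx
      rwa [absPerm_idx, ← inv_apply_eq.mp hinv, idx_pos] at this
    rw [List.map_append, List.sum_append, ih ρ hmem ⟨hTL, hP, rfl⟩, List.map_singleton,
      List.sum_singleton, sorR_eq_add hr one_val_pos hσfix, hinv, hmove, Nat.cast_add,
      sortWeight_one hr hik hki]
    ring

theorem sorB_eq_sorR (hr : Monotone r) (h1 : (1 : SignedPerm n) ∈ restricted r)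
    {σ : SignedPerm n} (hσ : σ ∈ restricted r) : σ.sorB = sorR r σ 1 := by
  have hset : {w : ℕ | ∃ L, IsSortingFactorization σ L ∧
      (w : ℤ) = (L.map fun p => p.2.1.1 - p.1.1 - if p.1.1 < 0 then 1 else 0).sum}
      = {sorR r σ 1} := by
    ext w
    rw [Set.mem_ofPred_eq, Set.mem_singleton_iff]
    constructor
    · rintro ⟨L, hL, hw⟩
      rw [sortingFactorization_weight hr h1 L σ hσ hL] at hw
      exact Int.natCast_inj.mp hw
    · rintro rfl
      obtain ⟨L, hL, -, -⟩ := exists_sortingFactorization n σ (fixesFrom_of_le le_rfl σ)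
      exact ⟨L, hL, (sortingFactorization_weight hr h1 L σ hσ hL).symm⟩
  rw [sorB, hset, csInf_singleton]

/-- If `r k ≤ k`, then `σ₀` would inject the `k + 1` positions up to `k` into the `k` letters below
`k`. -/
theorem one_mem_restricted (hr : Monotone r) {σ₀ : SignedPerm n} (hσ₀ : σ₀ ∈ restricted r) :
    (1 : SignedPerm n) ∈ restricted r := by
  rw [mem_restricted] at hσ₀ ⊢
  intro k
  have h1 : (1 : SignedPerm n).absPerm k = k := idx_pos k
  rw [h1]
  by_contra hc
  have hsub : (Finset.Iic k).map σ₀.absPerm.toEmbedding ⊆ Finset.Iio k := by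
    intro a ha
    rw [Finset.mem_map_equiv, Finset.mem_Iic] at ha
    have h2 := hσ₀ (σ₀.absPerm.symm a)
    rw [Equiv.apply_symm_apply] at h2
    have h3 := hr ha
    exact Finset.mem_Iio.mpr (Fin.lt_def.mpr (by omega))
  have h4 := Finset.card_le_card hsub
  rw [Finset.card_map, Fin.card_Iic, Fin.card_Iio] at h4
  omega

end SortingFactorization

/-! ### Specializations and equidistribution. -/

section Specializations

variable {R : Type*} [CommRing R]

theorem prod_cyc₀_mul_prod_cyc₁ (t s : Fin n → R) (π : SignedPerm n) :
    (∏ i ∈ π.cyc₀, t i) * ∏ i ∈ π.cyc₁, s i = ∏ j, cycleWeight t s 1 π j := by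
  have h : ∀ (S : Finset (Fin n)) (f : Fin n → R),
      ∏ i ∈ S, f i = ∏ j, if j ∈ S then f j else 1 := fun S f => by
    rw [Finset.prod_ite_mem, Finset.univ_inter]
  rw [h π.cyc₀ t, h π.cyc₁ s, ← Finset.prod_mul_distrib]
  refine Finset.prod_congr rfl fun j _ => ?_
  unfold cycleWeight
  by_cases h0 : j ∈ π.cyc₀
  · simp [h0, not_mem_cyc₁_of_mem_cyc₀ h0]
  · simp [h0]

theorem prod_ite_one_eq_pow {S : Finset (Fin n)} {m : ℕ} (h : m + S.card = n) (x : R) :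
    (∏ j, if j ∈ S then 1 else x) = x ^ m := by
  rw [Finset.prod_ite, Finset.prod_const_one, one_mul, Finset.prod_const,
    Finset.filter_notMem_eq_sdiff, Finset.card_sdiff_of_subset (Finset.subset_univ _),
    Finset.card_univ, Fintype.card_fin]
  congr 1
  omega

theorem prod_cycleWeight_reflectionLength (x : R) (π : SignedPerm n) :
    ∏ j, cycleWeight 1 (fun _ => x) (fun _ => x) π j = x ^ π.reflectionLength := by
  rw [← prod_ite_one_eq_pow π.reflectionLength_add_card_cyc₀]
  simp [cycleWeight]

/-- Splitting off the top power isolates the term of an unbalanced minimum; this compares the two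
shapes of the product when such minima carry the weight of non-minima. -/
theorem pow_mul_qInt_height {r : Fin n → ℕ} {σ₀ : SignedPerm n} (hσ₀ : σ₀ ∈ restricted r)
    (q : R) (k : Fin n) :
    q ^ (2 * (k + 1 : ℕ) - height r k) * qInt q (height r k)
      = q ^ (2 * (k + 1 : ℕ) - height r k) * qInt q (height r k - 1)
        + q ^ (2 * (k + 1 : ℕ) - 1) := by
  obtain ⟨m, hm⟩ : ∃ m, height r k = m + 1 := ⟨_, height_eq_card hσ₀ k⟩
  have hle := height_le r k
  have : 2 * (k + 1 : ℕ) - 1 = (2 * (k + 1 : ℕ) - (m + 1)) + m := by omega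
  rw [hm, Nat.add_sub_cancel, qInt, qInt, Finset.sum_range_succ, mul_add, this, pow_add]

theorem sum_sorR_reflectionLength {r : Fin n → ℕ} (hr : Monotone r) {σ₀ : SignedPerm n}
    (hσ₀ : σ₀ ∈ restricted r) (hpos : ∀ k, 0 < σ₀.val k) (q x : R) :
    ∑ σ ∈ restricted r, q ^ sorR r σ σ₀ * x ^ (σ * σ₀⁻¹).reflectionLength
      = ∏ k : Fin n, (1 + q * qInt q (height r k - 1) * x
          + q ^ (2 * (k + 1 : ℕ) - height r k) * qInt q (height r k) * x) := by
  have h := sum_sorR_cycleWeight hr hσ₀ hpos q 1 (fun _ => x) (fun _ => x)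
  simp only [prod_cycleWeight_reflectionLength] at h
  rw [h]
  refine Finset.prod_congr rfl fun k _ => ?_
  rw [pow_mul_qInt_height hσ₀, Pi.one_apply]
  ring

theorem sum_invB_nminB {r : Fin n → ℕ} (hr : Monotone r) {σ₀ : SignedPerm n}
    (hσ₀ : σ₀ ∈ restricted r) (hpos : ∀ k, 0 < σ₀.val k) (q x : R) :
    ∑ σ ∈ restricted r, q ^ σ.invB * x ^ σ.nminB
      = ∏ k : Fin n, (1 + q * qInt q (height r k - 1) * x
          + q ^ (2 * (k + 1 : ℕ) - height r k) * qInt q (height r k) * x) := by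
  have h := sum_invB_prlminl hr hσ₀ hpos q (fun _ => 1) (fun _ => x)
  simp only [prod_ite_one_eq_pow (nminB_add_card_prlminl _)] at h
  rw [h]
  refine Finset.prod_congr rfl fun k _ => ?_
  ring

end Specializations

open Polynomial in
-- With independent variables over `ℤ`, the inner one marking the first statistic and the outer one
-- the second, each coefficient is the number of elements with the given pair of values.
theorem card_filter_eq_of_sum_pow_eq {α : Type*} {A : Finset α} {f g f' g' : α → ℕ}
    (h : ∑ i ∈ A, (C X : ℤ[X][X]) ^ f i * X ^ g i = ∑ i ∈ A, (C X : ℤ[X][X]) ^ f' i * X ^ g' i)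
    (a b : ℕ) :
    (A.filter fun i => f i = a ∧ g i = b).card = (A.filter fun i => f' i = a ∧ g' i = b).card := by
  have key : ∀ u v : α → ℕ,
      ((∑ i ∈ A, (C X : ℤ[X][X]) ^ u i * X ^ v i).coeff b).coeff a
        = ((A.filter fun i => u i = a ∧ v i = b).card : ℤ) := by
    intro u v
    rw [finsetSum_coeff, finsetSum_coeff, Finset.card_filter, Nat.cast_sum]
    refine Finset.sum_congr rfl fun i _ => ?_
    rw [← C_pow, coeff_C_mul_X_pow]
    by_cases hv : b = v i
    · rw [if_pos hv, coeff_X_pow]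
      simp [hv, eq_comm]
    · rw [if_neg hv, coeff_zero]
      simp [Ne.symm hv]
  have h2 := congrArg (fun P : ℤ[X][X] => (P.coeff b).coeff a) h
  simp only [key] at h2
  exact_mod_cast h2

end SignedPerm

theorem mainTheorem10 {n : ℕ} (r : Fin n → ℕ) (hr : Monotone r) (hrn : ∀ k, r k ≤ n)
    (σ₀ : SignedPerm n) (hσ₀ : σ₀ ∈ SignedPerm.restricted r) (hpos : ∀ k, 0 < σ₀.val k)
    {R : Type*} [CommRing R] (q x : R) (t s : Fin n → R) :
    -- the joint distribution of the sorting index and of the two sets of cycle minima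
    (∑ σ ∈ SignedPerm.restricted r, q ^ SignedPerm.sorR r σ σ₀ *
          (∏ i ∈ (σ * σ₀⁻¹).cyc₀, t i) * (∏ i ∈ (σ * σ₀⁻¹).cyc₁, s i)
        = ∏ k : Fin n, (t k
            + (q + q ^ (2 * (k + 1 : ℕ) - height r k)) * qInt q (height r k - 1)
            + s k * q ^ (2 * (k + 1 : ℕ) - 1))) ∧
    -- the joint distribution of the sorting index and of the reflection length
    (∑ σ ∈ SignedPerm.restricted r,
          q ^ SignedPerm.sorR r σ σ₀ * x ^ (σ * σ₀⁻¹).reflectionLength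
        = ∏ k : Fin n, (1 + q * qInt q (height r k - 1) * x
            + q ^ (2 * (k + 1 : ℕ) - height r k) * qInt q (height r k) * x)) ∧
    (∑ σ ∈ SignedPerm.restricted r, q ^ σ.sorB * x ^ σ.reflectionLength
        = ∏ k : Fin n, (1 + q * qInt q (height r k - 1) * x
            + q ^ (2 * (k + 1 : ℕ) - height r k) * qInt q (height r k) * x)) ∧
    -- balanced cycle minima and positive right-to-left minimum letters
    (∑ σ ∈ SignedPerm.restricted r,
          q ^ SignedPerm.sorR r σ σ₀ * ∏ i ∈ (σ * σ₀⁻¹).cyc₀, t i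
        = ∑ σ ∈ SignedPerm.restricted r, q ^ σ.invB * ∏ i ∈ σ.prlminl, t i) ∧
    (∑ σ ∈ SignedPerm.restricted r, q ^ σ.invB * ∏ i ∈ σ.prlminl, t i
        = ∏ k : Fin n, (t k + q * qInt q (height r k - 1)
            + q ^ (2 * (k + 1 : ℕ) - height r k) * qInt q (height r k))) ∧
    -- the two equidistributed pairs of statistics
    (∑ σ ∈ SignedPerm.restricted r, q ^ σ.invB * x ^ σ.nminB
        = ∑ σ ∈ SignedPerm.restricted r,
            q ^ SignedPerm.sorR r σ σ₀ * x ^ (σ * σ₀⁻¹).reflectionLength) ∧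
    (∀ a b : ℕ,
      ((SignedPerm.restricted r).filter fun σ => σ.invB = a ∧ σ.nminB = b).card
        = ((SignedPerm.restricted r).filter fun σ =>
            SignedPerm.sorR r σ σ₀ = a ∧ (σ * σ₀⁻¹).reflectionLength = b).card) ∧
    (∑ σ ∈ SignedPerm.restricted r, q ^ σ.invB * x ^ σ.nminB
        = ∑ σ ∈ SignedPerm.restricted r, q ^ σ.sorB * x ^ σ.reflectionLength) := by

  have hone := SignedPerm.one_mem_restricted hr hσ₀
  have sorB : ∑ σ ∈ SignedPerm.restricted r, q ^ σ.sorB * x ^ σ.reflectionLength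
      = ∏ k : Fin n, (1 + q * qInt q (height r k - 1) * x
          + q ^ (2 * (k + 1 : ℕ) - height r k) * qInt q (height r k) * x) := by
    -- The product does not involve `σ₀`, so it is also the distribution for the target `1`.
    rw [← SignedPerm.sum_sorR_reflectionLength hr hone SignedPerm.one_val_pos q x]
    refine Finset.sum_congr rfl fun σ hσ => ?_
    rw [SignedPerm.sorB_eq_sorR hr hone hσ, inv_one, mul_one]
  have prlminl : ∑ σ ∈ SignedPerm.restricted r, q ^ σ.invB * ∏ i ∈ σ.prlminl, t i
      = ∏ k : Fin n, (t k + q * qInt q (height r k - 1)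
          + q ^ (2 * (k + 1 : ℕ) - height r k) * qInt q (height r k)) := by
    have h := SignedPerm.sum_invB_prlminl hr hσ₀ hpos q t (fun _ => 1)
    simp only [Finset.prod_ite_mem, Finset.univ_inter] at h
    rw [h]
    refine Finset.prod_congr rfl fun k _ => ?_
    ring
  refine ⟨?_, SignedPerm.sum_sorR_reflectionLength hr hσ₀ hpos q x, sorB, ?_, prlminl, ?_, ?_, ?_⟩
  · have h := SignedPerm.sum_sorR_cycleWeight hr hσ₀ hpos q t s 1
    simp only [← SignedPerm.prod_cyc₀_mul_prod_cyc₁, Pi.one_apply, one_mul] at h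
    simpa only [mul_assoc] using h
  · rw [prlminl]
    -- Unbalanced minima are not tracked here, so they get the weight `1` of the remaining letters.
    have h := SignedPerm.sum_sorR_cycleWeight hr hσ₀ hpos q t 1 1
    simp only [← SignedPerm.prod_cyc₀_mul_prod_cyc₁, Pi.one_apply, one_mul,
      Finset.prod_const_one, mul_one] at h
    rw [h]
    refine Finset.prod_congr rfl fun k _ => ?_
    rw [SignedPerm.pow_mul_qInt_height hσ₀]
    ring
  · rw [SignedPerm.sum_invB_nminB hr hσ₀ hpos, SignedPerm.sum_sorR_reflectionLength hr hσ₀ hpos q x]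
  · refine SignedPerm.card_filter_eq_of_sum_pow_eq ?_
    rw [SignedPerm.sum_invB_nminB hr hσ₀ hpos, SignedPerm.sum_sorR_reflectionLength hr hσ₀ hpos]
  · rw [SignedPerm.sum_invB_nminB hr hσ₀ hpos, sorB]
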